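/- For a squarefree integer $c\neq 1$ let $\Delta(c)$ denote the discriminant of the quadratic field $\mathbf{Q}(\sqrt c)$. Let $a,b\neq 1$ be squarefree integers (possibly equal, possibly negative), and let $(x,y,z)\in\mathbf{Q}^3$ be a non-zero solution of $x^2-ay^2-bz^2=0$. Put $K=\mathbf{Q}(\sqrt{ab})$, $E=\mathbf{Q}(\sqrt a,\sqrt b)$, $\beta=x+y\sqrt a$ and $F=F(x,y,z)=E(\sqrt\beta)$, and for $t\in\mathbf{Q}^*$ let $F_t=F(tx,ty,tz)=E(\sqrt{t\beta})$ be the quadratic twist of $F$ by $t$. (It is well known that $F_t$ is a cyclic extension of $K$ of degree $4$.) An extension of number fields is called unramified over a rational prime $p$ if all primes lying over $p$ are unramified in it. Let $p$ be a prime number with $p\nmid\Delta(b)$. 1. If $p\nmid\Delta(a)$, then $\mathbf{Q}\subset F_t$ is unramified over $p$ for a unique value $t\in\{1,p\}$ if $p$ is odd, and for a unique value $t\in\{\pm1,\pm2\}$ if $p=2$. 2. If $p$ is odd and $p\mid\Delta(a)$, then $K\subset F$ is unramified over $p$. 3. If $\Delta(a)$ is even and $\Delta(b)\equiv1\bmod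 8$, then $K\subset F_t$ is unramified over $2$ for exactly two values $t\in\{\pm1,\pm2\}$. 4. If $\Delta(a)$ is even and $\Delta(b)\equiv5\bmod 8$, then $K\subset F_t$ is ramified over $2$ for every $t\in\mathbf{Q}^*$, and $\Delta(a)\equiv4\bmod 8$. -/

import Mathlib

open NumberField

namespace RedeiField

/-- The field `ℚ(√c) ⊆ ℂ`. -/
noncomputable def sqrtField (c : ℤ) : IntermediateField ℚ ℂ :=
  IntermediateField.adjoin ℚ {w : ℂ | w ^ 2 = (c : ℂ)}

theorem finite_sqrt (c : ℤ) : {w : ℂ | w ^ 2 = (c : ℂ)}.Finite := by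
  obtain ⟨s, hs⟩ : ∃ s : ℂ, (c : ℂ) = s ^ 2 := (IsAlgClosed.exists_pow_nat_eq (c : ℂ) two_pos).imp fun _ h => h.symm
  refine (Set.toFinite {s, -s}).subset fun w hw => ?_
  exact sq_eq_sq_iff_eq_or_eq_neg.mp (hw.trans hs)

instance numberField_sqrtField (c : ℤ) : NumberField (sqrtField c) := by
  have : Finite {w : ℂ | w ^ 2 = (c : ℂ)} := finite_sqrt c
  have : FiniteDimensional ℚ (sqrtField c) := by
    refine IntermediateField.finiteDimensional_adjoin fun w hw => ?_
    refine IsIntegral.of_pow (n := 2) (by norm_num) ?_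
    rw [hw]
    exact_mod_cast isIntegral_algebraMap (R := ℚ) (A := ℂ) (x := (c : ℚ))
  exact ⟨⟩

/-- `Δ(c)`, the discriminant of the field `ℚ(√c)`. -/
noncomputable def Δ (c : ℤ) : ℤ := NumberField.discr (sqrtField c)

/-- The field `E = ℚ(√a, √b)`. -/
noncomputable def biquadField (a b : ℤ) : IntermediateField ℚ ℂ :=
  sqrtField a ⊔ sqrtField b

/-- The field `F(x, y, z) = E(√β)` with `E = ℚ(√a, √b)` and `β = x + y√a`; here `α` is the chosen
square root of `a`. (The coordinate `z` is determined up to sign by `x` and `y`.) -/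
noncomputable def extField (a b : ℤ) (α : ℂ) (x y : ℚ) : IntermediateField ℚ ℂ :=
  biquadField a b ⊔ IntermediateField.adjoin ℚ {w : ℂ | w ^ 2 = (x : ℂ) + (y : ℂ) * α}

/-- The quadratic twist `F_t = F(tx, ty, tz) = E(√(tβ))` of `F(x, y, z)`. -/
noncomputable def twist (a b : ℤ) (α : ℂ) (x y t : ℚ) : IntermediateField ℚ ℂ :=
  extField a b α (t * x) (t * y)

theorem sqrtField_mul_le_extField (a b : ℤ) (α : ℂ) (x y : ℚ) :
    sqrtField (a * b) ≤ extField a b α x y := by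
  refine le_trans ?_ (le_sup_left : biquadField a b ≤ _)
  refine IntermediateField.adjoin_le_iff.mpr fun w hw => ?_
  obtain ⟨s, hs⟩ : ∃ s : ℂ, (a : ℂ) = s ^ 2 := (IsAlgClosed.exists_pow_nat_eq (a : ℂ) two_pos).imp fun _ h => h.symm
  obtain ⟨r, hr⟩ : ∃ r : ℂ, (b : ℂ) = r ^ 2 := (IsAlgClosed.exists_pow_nat_eq (b : ℂ) two_pos).imp fun _ h => h.symm
  have h1 : s ∈ biquadField a b := (le_sup_left : sqrtField a ≤ _)
    (IntermediateField.subset_adjoin ℚ _ hs.symm)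
  have h2 : r ∈ biquadField a b := (le_sup_right : sqrtField b ≤ _)
    (IntermediateField.subset_adjoin ℚ _ hr.symm)
  have h : w ^ 2 = (s * r) ^ 2 := by
    rw [mul_pow, ← hs, ← hr]
    simpa using hw
  rcases sq_eq_sq_iff_eq_or_eq_neg.mp h with h | h
  · rw [h]
    exact mul_mem h1 h2
  · rw [h]
    exact neg_mem (mul_mem h1 h2)

/-- The field `F(x, y, z)` regarded as an extension field of `K = ℚ(√(ab))`. -/
noncomputable def extFieldOverK (a b : ℤ) (α : ℂ) (x y : ℚ) :
    IntermediateField (sqrtField (a * b)) ℂ :=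
  IntermediateField.extendScalars (sqrtField_mul_le_extField a b α x y)

/-- The twist `F_t` regarded as an extension field of `K = ℚ(√(ab))`. -/
noncomputable def twistOverK (a b : ℤ) (α : ℂ) (x y t : ℚ) :
    IntermediateField (sqrtField (a * b)) ℂ :=
  extFieldOverK a b α (t * x) (t * y)

/-- The extension of number fields `K ⊆ L` is unramified over the rational prime `p`: every prime
of `K` dividing `p` is unramified in `L`. -/
def UnramifiedOver (K L : Type*) [Field K] [Field L] [Algebra K L] (p : ℕ) : Prop :=
  ∀ 𝔭 : Ideal (𝓞 K), 𝔭.IsPrime → (p : 𝓞 K) ∈ 𝔭 → Algebra.IsUnramifiedIn (𝓞 L) 𝔭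

end RedeiField

/-!
A prime `P` over `p` is unramified in a Galois extension of the base field exactly when every
element of the inertia group of `P` fixing the base is trivial. So the question is which of the
square roots of `a`, `b` and `tβ` are fixed by inertia.

Scaling a solution by `q²r` with `r ∈ {1, p}` makes it a primitive integral one. The identity
`(x + z√b + y√a)² = 2(x + y√a)(x + z√b)` exchanges the roles of `a` and `b` in `F`, and for odd `p`
one of `x + y√a`, `x + z√b` is a unit at `P` for a primitive solution, so that its square root is
fixed by inertia.

At `2`, the inertia groups fix `√n` exactly for `n = 4ᵏ(4m + 1)`, and two unramified twists `F_t`,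
`F_s` have `√(ts)` in their compositum; this bounds the number of unramified twists. If
`b ≡ 1 mod 8`, a `2`-adic approximation `w` of `√b` replaces `2(x + z√b)` by an integer `n`, and
`F_t` is unramified over `K` exactly if `tn` or `tna` has that form. If `b ≡ 5 mod 8`, a Frobenius
element moves `√b` and some inertia element moves `√a`; their commutator lies in the inertia group,
fixes `E`, and acts non-trivially on every twist.
-/

namespace RedeiField

section Inertia

variable {K L : Type*} [Field K] [NumberField K] [Field L] [NumberField L] [Algebra K L]

theorem card_inertia_eq_ramificationIdx (G : Type*) [Group G] [Finite G]
    [MulSemiringAction G (𝓞 L)] [IsGaloisGroup G (𝓞 K) (𝓞 L)] {P : Ideal (𝓞 L)} [P.IsPrime]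
    (hP : P ≠ ⊥) : Nat.card (P.inertia G) = P.ramificationIdx (𝓞 K) := by
  have hbot : P.under (𝓞 K) ≠ ⊥ := Ideal.IsIntegral.comap_ne_bot (𝓞 K) hP
  have : (P.under (𝓞 K)).IsMaximal := Ideal.IsPrime.isMaximal inferInstance hbot
  have : Finite (𝓞 K ⧸ P.under (𝓞 K)) := Ring.HasFiniteQuotients.finiteQuotient hbot
  rw [Ideal.card_inertia_eq_ramificationIdxIn (P.under (𝓞 K)) P,
    Ideal.ramificationIdxIn_eq_ramificationIdx (P.under (𝓞 K)) P G]

theorem isUnramifiedAt_iff_inertia_eq_bot [IsGalois K L] {P : Ideal (𝓞 L)} [P.IsPrime]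
    (hP : P ≠ ⊥) : Algebra.IsUnramifiedAt (𝓞 K) P ↔ P.inertia Gal(L/K) = ⊥ := by
  have hbot : P.under (𝓞 K) ≠ ⊥ := Ideal.IsIntegral.comap_ne_bot (𝓞 K) hP
  have : (P.under (𝓞 K)).IsMaximal := Ideal.IsPrime.isMaximal inferInstance hbot
  have : Finite (𝓞 K ⧸ P.under (𝓞 K)) := Ring.HasFiniteQuotients.finiteQuotient hbot
  rw [← Ideal.ramificationIdx_eq_one_iff, ← card_inertia_eq_ramificationIdx Gal(L/K) hP,
    Subgroup.card_eq_one]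

variable {p : ℕ}

theorem ne_bot_of_natCast_mem (hp : p ≠ 0) {P : Ideal (𝓞 L)} (h : (p : 𝓞 L) ∈ P) : P ≠ ⊥ := by
  rintro rfl
  exact hp (by exact_mod_cast Ideal.mem_bot.mp h)

theorem unramifiedOver_iff_inertia_eq_bot [IsGalois K L] (hp : p ≠ 0) :
    UnramifiedOver K L p ↔
      ∀ P : Ideal (𝓞 L), P.IsPrime → (p : 𝓞 L) ∈ P → P.inertia Gal(L/K) = ⊥ := by
  constructor
  · intro h P _ hpP
    exact (isUnramifiedAt_iff_inertia_eq_bot (ne_bot_of_natCast_mem hp hpP)).mp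
      (h (P.under (𝓞 K)) inferInstance (by simpa using hpP) P inferInstance ⟨rfl⟩)
  · intro h 𝔭 _ hp𝔭 P _ _
    have hpP : (p : 𝓞 L) ∈ P := by simpa using (Ideal.mem_of_liesOver P 𝔭 (p : 𝓞 K)).mp hp𝔭
    exact (isUnramifiedAt_iff_inertia_eq_bot (ne_bot_of_natCast_mem hp hpP)).mpr
      (h P inferInstance hpP)

theorem restrictNormal_mem_inertia {K L M : Type*} [Field K] [Field L] [Field M] [Algebra K L]
    [Algebra K M] [Algebra L M] [IsScalarTower K L M] [Normal K L] {P : Ideal (𝓞 M)}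
    {σ : Gal(M/K)} (hσ : σ ∈ P.inertia Gal(M/K)) :
    σ.restrictNormal L ∈ (P.under (𝓞 L)).inertia Gal(L/K) := by
  rw [AddSubgroup.mem_inertia] at hσ ⊢
  intro x
  have hcomm : algebraMap (𝓞 L) (𝓞 M) (σ.restrictNormal L • x) =
      σ • algebraMap (𝓞 L) (𝓞 M) x := RingOfIntegers.ext (AlgEquiv.restrictNormal_commutes σ L x)
  change algebraMap (𝓞 L) (𝓞 M) (σ.restrictNormal L • x - x) ∈ P
  rw [map_sub, hcomm]
  exact hσ _

theorem UnramifiedOver.map_eq_of_mem_inertia [IsGalois K L] (hp : p ≠ 0)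
    (h : UnramifiedOver K L p) {M : Type*} [Field M] [Algebra K M] (i : L →ₐ[K] M)
    {P : Ideal (𝓞 M)} [P.IsPrime] (hpP : (p : 𝓞 M) ∈ P) {σ : Gal(M/K)}
    (hσ : σ ∈ P.inertia Gal(M/K)) (x : L) : σ (i x) = i x := by
  let : Algebra L M := i.toRingHom.toAlgebra
  have : IsScalarTower K L M := .of_algebraMap_eq fun r ↦ (i.commutes r).symm
  have hbot := (unramifiedOver_iff_inertia_eq_bot hp).mp h (P.under (𝓞 L)) inferInstance
    (by simpa using hpP)
  have hone : σ.restrictNormal L = 1 := by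
    rw [← Subgroup.mem_bot, ← hbot]
    exact restrictNormal_mem_inertia hσ
  have hx : i (σ.restrictNormal L x) = σ (i x) := AlgEquiv.restrictNormal_commutes σ L x
  rw [← hx, hone, AlgEquiv.one_apply]

theorem UnramifiedOver.sup {Ω : Type*} [Field Ω] [Algebra K Ω] {E F : IntermediateField K Ω}
    [NumberField E] [NumberField F] [NumberField ↥(E ⊔ F)] [IsGalois K E] [IsGalois K F]
    (hp : p ≠ 0) (hE : UnramifiedOver K E p) (hF : UnramifiedOver K F p) :
    UnramifiedOver K ↥(E ⊔ F) p := by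
  rw [unramifiedOver_iff_inertia_eq_bot hp]
  intro P _ hpP
  rw [Subgroup.eq_bot_iff_forall]
  intro σ hσ
  have hfix : (σ : ↥(E ⊔ F) →ₐ[K] ↥(E ⊔ F)) = AlgHom.id K _ := by
    refine IntermediateField.algHom_ext_of_eq_adjoin K (IntermediateField.sup_def E F) ?_
    rintro x (hx | hx)
    · exact hE.map_eq_of_mem_inertia hp (IntermediateField.inclusion le_sup_left) hpP hσ ⟨x, hx⟩
    · exact hF.map_eq_of_mem_inertia hp (IntermediateField.inclusion le_sup_right) hpP hσ ⟨x, hx⟩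
  exact AlgEquiv.ext fun x ↦ DFunLike.congr_fun hfix x

theorem mem_pow_ramificationIdx_of_fixed [IsGalois K L] {P : Ideal (𝓞 L)} [P.IsPrime] (hP : P ≠ ⊥)
    {x : 𝓞 L} (hx : x ∈ P) (hfix : ∀ σ ∈ P.inertia Gal(L/K), σ • x = x) :
    x ∈ P ^ P.ramificationIdx (𝓞 K) := by
  let I := P.inertia Gal(L/K)
  let E : IntermediateField K L := FixedPoints.intermediateField I
  have : IsGaloisGroup I E L := IsGaloisGroup.subgroup Gal(L/K) K L I
  have : IsGaloisGroup I (𝓞 E) (𝓞 L) := .of_isFractionRing _ _ _ E L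
  have hI : P.inertia I = ⊤ := (Subgroup.eq_top_iff' _).mpr fun σ ↦ σ.2
  have he : P.ramificationIdx (𝓞 E) = P.ramificationIdx (𝓞 K) := by
    rw [← card_inertia_eq_ramificationIdx I hP, ← card_inertia_eq_ramificationIdx Gal(L/K) hP, hI,
      Subgroup.card_top]
  have hxE : (x : L) ∈ E := fun σ ↦ congrArg ((↑) : 𝓞 L → L) (hfix σ σ.2)
  obtain ⟨y, rfl⟩ : ∃ y : 𝓞 E, algebraMap (𝓞 E) (𝓞 L) y = x :=
    ⟨⟨⟨x, hxE⟩, (isIntegral_algebraMap_iff (algebraMap E L).injective).mp x.2⟩, rfl⟩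
  have hle := Ideal.le_pow_ramificationIdx' (p := P.under (𝓞 E)) (P := P)
  rw [Ideal.ramificationIdx'_eq_ramificationIdx _ _ (Ideal.IsIntegral.comap_ne_bot (𝓞 E) hP),
    he] at hle
  exact hle (Ideal.mem_map_of_mem _ hx)

theorem intCast_mem_iff (hp : p.Prime) {P : Ideal (𝓞 L)} [hP : P.IsPrime]
    (hpP : (p : 𝓞 L) ∈ P) (n : ℤ) : (n : 𝓞 L) ∈ P ↔ (p : ℤ) ∣ n := by
  constructor
  · intro hn
    by_contra hpn
    obtain ⟨u, v, huv⟩ := (Nat.prime_iff_prime_int.mp hp).coprime_iff_not_dvd.mpr hpn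
    have hone : (u * p + v * n : 𝓞 L) = 1 := by exact_mod_cast congrArg (Int.cast : ℤ → 𝓞 L) huv
    refine hP.one_notMem (hone ▸ ?_)
    exact P.add_mem (P.mul_mem_left _ hpP) (P.mul_mem_left _ hn)
  · rintro ⟨m, rfl⟩
    push_cast
    exact P.mul_mem_right _ hpP

theorem le_ramificationIdx_of_natCast_mem_pow (hp : p.Prime) {P : Ideal (𝓞 L)} [hP : P.IsPrime]
    (hpP : (p : 𝓞 L) ∈ P) {k : ℕ} (hk : (p : 𝓞 L) ∈ P ^ k) : k ≤ P.ramificationIdx (𝓞 ℚ) := by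
  have hbot : P.under (𝓞 ℚ) ≠ ⊥ :=
    Ideal.IsIntegral.comap_ne_bot (𝓞 ℚ) (ne_bot_of_natCast_mem hp.ne_zero hpP)
  have hmap : Ideal.map (algebraMap (𝓞 ℚ) (𝓞 L)) (P.under (𝓞 ℚ)) ≤ P ^ k := by
    rw [Ideal.map_le_iff_le_comap]
    intro x hx
    obtain ⟨n, rfl⟩ : ∃ n : ℤ, (n : 𝓞 ℚ) = x :=
      ⟨Rat.ringOfIntegersEquiv x, Rat.ringOfIntegersEquiv.injective (by simp)⟩
    obtain ⟨m, rfl⟩ := (intCast_mem_iff hp hpP n).mp (by simpa [Ideal.mem_comap] using hx)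
    simpa [Ideal.mem_comap] using Ideal.mul_mem_right _ _ hk
  rw [← Ideal.ramificationIdx'_eq_ramificationIdx _ P hbot,
    Ideal.IsDedekindDomain.ramificationIdx'_eq_multiplicity (Ideal.map_ne_bot_of_ne_bot hbot) hP]
  exact FiniteMultiplicity.le_multiplicity_of_pow_dvd
    (.of_not_isUnit (mt Ideal.isUnit_iff.mp hP.ne_top) (Ideal.map_ne_bot_of_ne_bot hbot))
    (Ideal.dvd_iff_le.mpr hmap)

theorem exists_mem_inertia_smul_ne [IsGalois ℚ L] (hp : p.Prime) {P : Ideal (𝓞 L)} [P.IsPrime]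
    (hpP : (p : 𝓞 L) ∈ P) {π u : 𝓞 L} {n : ℕ} (hn : 1 < n) (hu : u ∉ P) (hπ : π ^ n = p * u) :
    ∃ σ ∈ P.inertia Gal(L/ℚ), σ • π ≠ π := by
  by_contra! hfix
  have hP := ne_bot_of_natCast_mem hp.ne_zero hpP
  have hπP : π ∈ P := Ideal.IsPrime.mem_of_pow_mem ‹_› n (hπ ▸ P.mul_mem_right u hpP)
  have hπe : u * p ∈ P ^ (P.ramificationIdx (𝓞 ℚ) * n) := by
    rw [mul_comm u, ← hπ, pow_mul]
    exact Ideal.pow_mem_pow (mem_pow_ramificationIdx_of_fixed hP hπP hfix) n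
  have hle := le_ramificationIdx_of_natCast_mem_pow hp hpP
    ((Ideal.IsPrime.mul_mem_pow P hπe).resolve_left hu)
  have hpos := Ideal.ramificationIdx_pos P (𝓞 ℚ)
  nlinarith

end Inertia

section TwoAdicClass

/-- `n` is `4 ^ k` times an integer congruent to `1` modulo `4`. For nonzero `n` this says that
`ℚ(√n)` is unramified over `2`. -/
def IsFourPowMulOneMod (n : ℤ) : Prop := ∃ (k : ℕ) (m : ℤ), n = 4 ^ k * (4 * m + 1)

/-- Representatives of the nonzero integers modulo those satisfying `IsFourPowMulOneMod`, that is,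
of the quadratic twists modulo those which are unramified over `2`. -/
def twistReps : Set ℤ := {1, -1, 2, -2}

theorem cast_image_twistReps : ((↑) : ℤ → ℚ) '' twistReps = {1, -1, 2, -2} := by
  simp [twistReps, Set.image_insert_eq]

theorem ne_zero_of_mem_twistReps {t : ℤ} (ht : t ∈ twistReps) : t ≠ 0 := by
  rintro rfl
  simp [twistReps] at ht

theorem exists_eq_four_pow_mul {n : ℤ} (hn : n ≠ 0) :
    ∃ (k : ℕ) (c : ℤ), n = 4 ^ k * c ∧ ¬ 4 ∣ c := by
  obtain ⟨c, hc, h⟩ := (Int.finiteMultiplicity_iff.mpr ⟨by decide, hn⟩ :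
    FiniteMultiplicity 4 n).exists_eq_pow_mul_and_not_dvd
  exact ⟨_, c, hc, h⟩

theorem isFourPowMulOneMod_four_pow_mul_iff (k : ℕ) {c : ℤ} (hc : ¬ 4 ∣ c) :
    IsFourPowMulOneMod (4 ^ k * c) ↔ c % 4 = 1 := by
  have h4 (i : ℕ) : (4 : ℤ) ^ i ≠ 0 := pow_ne_zero i (by decide)
  constructor
  · rintro ⟨j, m, h⟩
    rcases lt_trichotomy k j with hkj | rfl | hkj
    · obtain ⟨d, rfl⟩ := Nat.exists_eq_add_of_lt hkj
      refine absurd ⟨4 ^ d * (4 * m + 1), mul_left_cancel₀ (h4 k) ?_⟩ hc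
      linear_combination h
    · have := mul_left_cancel₀ (h4 k) h
      omega
    · obtain ⟨d, rfl⟩ := Nat.exists_eq_add_of_lt hkj
      have : 4 * m + 1 = 4 * (4 ^ d * c) := by
        refine mul_left_cancel₀ (h4 j) ?_
        linear_combination -h
      omega
  · exact fun h ↦ ⟨k, c / 4, by congr 1; omega⟩

namespace IsFourPowMulOneMod

theorem mul_iff {m n : ℤ} (hm : IsFourPowMulOneMod m) (hn : n ≠ 0) :
    IsFourPowMulOneMod (m * n) ↔ IsFourPowMulOneMod n := by
  obtain ⟨j, m, rfl⟩ := hm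
  obtain ⟨k, c, rfl, hc⟩ := exists_eq_four_pow_mul hn
  have hmod : ((4 * m + 1) * c) % 4 = c % 4 := by
    rw [show (4 * m + 1) * c = c + 4 * (m * c) by ring]
    omega
  rw [show 4 ^ j * (4 * m + 1) * (4 ^ k * c) = 4 ^ (j + k) * ((4 * m + 1) * c) by ring,
    isFourPowMulOneMod_four_pow_mul_iff _ hc, isFourPowMulOneMod_four_pow_mul_iff _ (by omega),
    hmod]

theorem sq {n : ℤ} (hn : n ≠ 0) : IsFourPowMulOneMod (n ^ 2) := by
  obtain ⟨c, hc, h2⟩ := (Int.finiteMultiplicity_iff.mpr ⟨by decide, hn⟩ :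
    FiniteMultiplicity 2 n).exists_eq_pow_mul_and_not_dvd
  obtain ⟨d, rfl⟩ : ∃ d, c = 2 * d + 1 := ⟨c / 2, by omega⟩
  refine ⟨multiplicity 2 n, d ^ 2 + d, ?_⟩
  nth_rw 1 [hc]
  rw [mul_pow, ← pow_mul, mul_comm _ 2, pow_mul]
  ring

theorem sq_mul_iff {m n : ℤ} (hm : m ≠ 0) (hn : n ≠ 0) :
    IsFourPowMulOneMod (m ^ 2 * n) ↔ IsFourPowMulOneMod n :=
  (sq hm).mul_iff hn

theorem exists_mul {n : ℤ} (hn : n ≠ 0) : ∃ t ∈ twistReps, IsFourPowMulOneMod (t * n) := by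
  obtain ⟨k, c, rfl, hc⟩ := exists_eq_four_pow_mul hn
  have h : c % 8 = 2 ∨ c % 8 = 6 ∨ c % 4 = 1 ∨ c % 4 = 3 := by omega
  rcases h with h | h | h | h
  · obtain ⟨d, rfl⟩ : ∃ d, c = 8 * d + 2 := ⟨c / 8, by omega⟩
    exact ⟨2, by simp [twistReps], k + 1, d, by ring⟩
  · obtain ⟨d, rfl⟩ : ∃ d, c = 8 * d + 6 := ⟨c / 8, by omega⟩
    exact ⟨-2, by simp [twistReps], k + 1, -d - 1, by ring⟩
  · obtain ⟨d, rfl⟩ : ∃ d, c = 4 * d + 1 := ⟨c / 4, by omega⟩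
    exact ⟨1, by simp [twistReps], k, d, by ring⟩
  · obtain ⟨d, rfl⟩ : ∃ d, c = 4 * d + 3 := ⟨c / 4, by omega⟩
    exact ⟨-1, by simp [twistReps], k, -d - 1, by ring⟩

theorem mul_trans {s t n : ℤ} (hst : IsFourPowMulOneMod (s * t)) (htn : IsFourPowMulOneMod (t * n))
    (hs : s ≠ 0) (ht : t ≠ 0) (hn : n ≠ 0) : IsFourPowMulOneMod (s * n) := by
  rw [← sq_mul_iff ht (mul_ne_zero hs hn), show t ^ 2 * (s * n) = s * t * (t * n) by ring]
  exact (hst.mul_iff (mul_ne_zero ht hn)).mpr htn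

theorem eq_of_mul {s t : ℤ} (hs : s ∈ twistReps) (ht : t ∈ twistReps)
    (h : IsFourPowMulOneMod (s * t)) : s = t := by
  obtain ⟨k, m, hm⟩ := h
  have hmod : (s * t) % 4 = 1 ∨ (s * t) % 16 = 4 ∨ (s * t) % 16 = 0 := by
    rcases k with - | - | k
    · omega
    · omega
    · rw [show (4 : ℤ) ^ (k + 1 + 1) * (4 * m + 1) = 16 * (4 ^ k * (4 * m + 1)) by ring] at hm
      omega
  rcases hs with rfl | rfl | rfl | rfl <;> rcases ht with rfl | rfl | rfl | rfl <;> simp at hmod ⊢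

theorem existsUnique_mul {n : ℤ} (hn : n ≠ 0) :
    ∃! t, t ∈ twistReps ∧ IsFourPowMulOneMod (t * n) := by
  obtain ⟨t, ht, htn⟩ := exists_mul hn
  refine ⟨t, ⟨ht, htn⟩, fun s ⟨hs, hsn⟩ ↦ eq_of_mul hs ht ?_⟩
  exact hsn.mul_trans (mul_comm t n ▸ htn) (ne_zero_of_mem_twistReps hs) hn
    (ne_zero_of_mem_twistReps ht)

theorem ncard_twistReps_eq_two {n a : ℤ} (hn : n ≠ 0) (ha0 : a ≠ 0) (ha : ¬ IsFourPowMulOneMod a) :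
    {t ∈ twistReps | IsFourPowMulOneMod (t * n) ∨ IsFourPowMulOneMod (t * (n * a))}.ncard = 2 := by
  obtain ⟨s, ⟨hs, hsn⟩, hs_unique⟩ := existsUnique_mul hn
  obtain ⟨t, ⟨ht, htn⟩, ht_unique⟩ := existsUnique_mul (mul_ne_zero hn ha0)
  rw [Set.ncard_eq_two]
  refine ⟨s, t, ?_, Set.ext fun r ↦ ⟨?_, ?_⟩⟩
  · rintro rfl
    rw [← mul_assoc, hsn.mul_iff ha0] at htn
    exact ha htn
  · rintro ⟨hr, h | h⟩
    exacts [.inl (hs_unique r ⟨hr, h⟩), .inr (ht_unique r ⟨hr, h⟩)]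
  · rintro (rfl | rfl)
    exacts [⟨hs, .inl hsn⟩, ⟨ht, .inr htn⟩]

end IsFourPowMulOneMod

end TwoAdicClass

section SquareRoots

variable {K L : Type*} [Field K] [Field L] [Algebra K L] {P : Ideal (𝓞 L)} [P.IsPrime]
  {σ : Gal(L/K)}

theorem exists_ringOfIntegers_of_sq_eq {θ : L} {u : 𝓞 L} (h : θ ^ 2 = u) :
    ∃ y : 𝓞 L, (y : L) = θ ∧ y ^ 2 = u :=
  ⟨⟨θ, IsIntegral.of_pow two_pos (h ▸ u.2)⟩, rfl, RingOfIntegers.ext h⟩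

theorem map_eq_or_eq_neg_of_sq {θ : L} (h : σ (θ ^ 2) = θ ^ 2) : σ θ = θ ∨ σ θ = -θ :=
  sq_eq_sq_iff_eq_or_eq_neg.mp (by rwa [map_pow] at h)

theorem map_eq_of_sq_eq_of_two_notMem (h2 : (2 : 𝓞 L) ∉ P) (hσ : σ ∈ P.inertia Gal(L/K)) {θ : L}
    {u : 𝓞 L} (hu : u ∉ P) (hθ : θ ^ 2 = u) (hσu : σ u = u) : σ θ = θ := by
  refine (map_eq_or_eq_neg_of_sq (by rw [hθ, hσu])).resolve_right fun hneg ↦ hu ?_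
  obtain ⟨θ, rfl, rfl⟩ := exists_ringOfIntegers_of_sq_eq hθ
  have hdiff : σ • θ - θ = -(2 * θ) := RingOfIntegers.ext <| by
    change σ θ - θ = -(2 * θ)
    rw [hneg]
    ring
  have hmem : 2 * θ ∈ P := by rw [← neg_mem_iff, ← hdiff]; exact hσ θ
  exact Ideal.pow_mem_of_mem P ((Ideal.IsPrime.mem_or_mem ‹_› hmem).resolve_left h2) 2 two_pos

theorem map_eq_of_sq_eq_sq_add_four_mul [CharZero L] (h2 : (2 : 𝓞 L) ∈ P)
    (hσ : σ ∈ P.inertia Gal(L/K)) {θ : L} {s e : 𝓞 L} (hs : s ∉ P)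
    (hθ : θ ^ 2 = (s : L) ^ 2 + 4 * e) (hσs : σ s = s) (hσe : σ e = e) : σ θ = θ := by
  have hσθ : σ (θ ^ 2) = θ ^ 2 := by simp only [hθ, map_add, map_pow, map_mul, map_ofNat, hσs, hσe]
  refine (map_eq_or_eq_neg_of_sq hσθ).resolve_right fun hneg ↦ hs ?_
  obtain ⟨θ, rfl, hθ'⟩ := exists_ringOfIntegers_of_sq_eq (u := s ^ 2 + 4 * e)
    (by simpa only [map_add, map_mul, map_pow, map_ofNat] using hθ)
  have hint : IsIntegral (𝓞 L) ((s + θ : L) / 2) := by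
    refine ⟨Polynomial.X ^ 2 - Polynomial.C s * Polynomial.X - Polynomial.C e, by monicity!, ?_⟩
    simp only [Polynomial.eval₂_sub, Polynomial.eval₂_mul, Polynomial.eval₂_pow,
      Polynomial.eval₂_X, Polynomial.eval₂_C]
    linear_combination hθ / 4
  let ω : 𝓞 L := ⟨(s + θ) / 2, isIntegral_trans _ hint⟩
  have hdiff : σ • ω - ω = -θ := RingOfIntegers.ext <| by
    change σ ((s + θ : L) / 2) - (s + θ) / 2 = -θ
    rw [map_div₀, map_add, hσs, hneg, map_ofNat]
    ring
  have hθP : θ ∈ P := by rw [← neg_mem_iff, ← hdiff]; exact hσ ω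
  refine Ideal.IsPrime.mem_of_pow_mem ‹_› 2 ?_
  rw [show s ^ 2 = θ ^ 2 - 2 * (2 * e) by rw [hθ']; ring]
  exact P.sub_mem (Ideal.pow_mem_of_mem P hθP 2 two_pos) (P.mul_mem_right _ h2)

theorem exists_ringOfIntegers_of_sq_eq_intCast {θ : L} {n : ℤ} (h : θ ^ 2 = n) :
    ∃ y : 𝓞 L, (y : L) = θ ∧ y ^ 2 = n :=
  exists_ringOfIntegers_of_sq_eq (by simpa using h)

theorem exists_eq_two_mul_sub_one [CharZero L] {A : L} {a : ℤ} (hA : A ^ 2 = a) (ha : a % 4 = 1) :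
    ∃ ω : 𝓞 L, A = 2 * ω - 1 := by
  obtain ⟨k, rfl⟩ : ∃ k, a = 4 * k + 1 := ⟨a / 4, by omega⟩
  have hint : IsIntegral ℤ ((1 + A) / 2) := by
    refine ⟨Polynomial.X ^ 2 - Polynomial.X - Polynomial.C k, by monicity!, ?_⟩
    push_cast at hA
    rw [Polynomial.eval₂_sub, Polynomial.eval₂_sub, Polynomial.eval₂_pow, Polynomial.eval₂_X,
      Polynomial.eval₂_C, algebraMap_int_eq, eq_intCast]
    linear_combination hA / 4
  exact ⟨⟨_, hint⟩, show A = 2 * ((1 + A) / 2) - 1 by ring⟩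

theorem map_eq_of_sq_eq_add_mul [CharZero L] (h2 : (2 : 𝓞 L) ∈ P) (hσ : σ ∈ P.inertia Gal(L/K))
    {A R : L} {a u v : ℤ} (hA : A ^ 2 = a) (ha : a % 4 = 1) (hσA : σ A = A)
    (hR : R ^ 2 = u + v * A) (hv : v % 2 = 0) (huv : (u - v) % 4 = 1) : σ R = R := by
  obtain ⟨ω, rfl⟩ := exists_eq_two_mul_sub_one hA ha
  obtain ⟨w, rfl⟩ : ∃ w, v = 2 * w := ⟨v / 2, by omega⟩
  obtain ⟨k, rfl⟩ : ∃ k, u = 4 * k + 1 + 2 * w := ⟨(u - 2 * w) / 4, by omega⟩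
  have hσω : σ ω = ω := by simpa [map_sub, map_mul, map_ofNat] using hσA
  refine map_eq_of_sq_eq_sq_add_four_mul h2 hσ (s := 1) (e := k + w * ω)
    ((Ideal.ne_top_iff_one P).mp Ideal.IsPrime.ne_top') ?_ (by simp) (by simp [hσω])
  rw [hR]
  push_cast [map_add, map_mul]
  simp
  ring

theorem map_eq_of_sq_eq_intCast [CharZero L] (h2 : (2 : 𝓞 L) ∈ P) (hσ : σ ∈ P.inertia Gal(L/K))
    {s : L} {n : ℤ} (hs : s ^ 2 = n) (hn : n % 4 = 1) : σ s = s :=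
  map_eq_of_sq_eq_add_mul h2 hσ (A := 1) (a := 1) (u := n) (v := 0) (by simp) rfl (map_one σ)
    (by simpa using hs) rfl (by simpa using hn)

end SquareRoots

section MovedSquareRoots

variable {L : Type*} [Field L] [NumberField L] [IsGalois ℚ L] {P : Ideal (𝓞 L)} [P.IsPrime]

theorem exists_mem_inertia_map_ne_of_sq_eq_mul {p : ℕ} (hp : p.Prime) (hpP : (p : 𝓞 L) ∈ P)
    {s : L} {m : ℤ} (hm : ¬ (p : ℤ) ∣ m) (hs : s ^ 2 = p * m) :
    ∃ σ ∈ P.inertia Gal(L/ℚ), σ s ≠ s := by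
  obtain ⟨s, rfl, hs'⟩ := exists_ringOfIntegers_of_sq_eq_intCast (θ := s) (n := p * m)
    (by simpa using hs)
  obtain ⟨σ, hσ, hσs⟩ := exists_mem_inertia_smul_ne hp hpP one_lt_two
    (mt (intCast_mem_iff hp hpP m).mp hm) (by simpa using hs')
  exact ⟨σ, hσ, fun h ↦ hσs (RingOfIntegers.ext h)⟩

theorem exists_mem_inertia_map_ne_of_sq_eq_three (h2 : (2 : 𝓞 L) ∈ P) {s : L} {c : ℤ}
    (hc : c % 4 = 3) (hs : s ^ 2 = c) : ∃ σ ∈ P.inertia Gal(L/ℚ), σ s ≠ s := by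
  obtain ⟨m, rfl⟩ : ∃ m, c = 2 * (2 * m + 1) + 1 := ⟨c / 4, by omega⟩
  obtain ⟨s, rfl, hs'⟩ := exists_ringOfIntegers_of_sq_eq_intCast hs
  have hu : ((2 * m + 2 : ℤ) + s : 𝓞 L) ∉ P := fun hu ↦ by
    have hsP : s ∈ P := (Ideal.add_mem_iff_right P (by
      push_cast
      rw [show (2 * m + 2 : 𝓞 L) = 2 * (m + 1) by ring]
      exact P.mul_mem_right _ h2)).mp hu
    have hmem := (intCast_mem_iff Nat.prime_two (by simpa using h2) _).mp
      (hs' ▸ Ideal.pow_mem_of_mem P hsP 2 two_pos)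
    push_cast at hmem
    omega
  obtain ⟨σ, hσ, hσs⟩ := exists_mem_inertia_smul_ne (π := 1 + s) Nat.prime_two (by simpa using h2)
    one_lt_two hu (by push_cast at hs' ⊢; linear_combination hs')
  exact ⟨σ, hσ, fun h ↦ hσs (by rw [smul_add, smul_one, show σ • s = s from RingOfIntegers.ext h])⟩

theorem exists_mem_inertia_map_ne_of_not_isFourPowMulOneMod (h2 : (2 : 𝓞 L) ∈ P) {s : L} {n : ℤ}
    (hn : n ≠ 0) (hnU : ¬ IsFourPowMulOneMod n) (hs : s ^ 2 = n) :
    ∃ σ ∈ P.inertia Gal(L/ℚ), σ s ≠ s := by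
  obtain ⟨k, c, rfl, hc⟩ := exists_eq_four_pow_mul hn
  rw [isFourPowMulOneMod_four_pow_mul_iff k hc] at hnU
  have hs' : (s / 2 ^ k) ^ 2 = c := by
    rw [div_pow, hs, ← pow_mul, mul_comm k, pow_mul]
    push_cast
    norm_num
  suffices h : ∃ σ ∈ P.inertia Gal(L/ℚ), σ (s / 2 ^ k) ≠ s / 2 ^ k by
    obtain ⟨σ, hσ, hne⟩ := h
    exact ⟨σ, hσ, fun h ↦ hne (by rw [map_div₀, h, map_pow, map_ofNat])⟩
  rcases show c % 4 = 2 ∨ c % 4 = 3 by omega with h | h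
  · obtain ⟨m, rfl⟩ : ∃ m, c = 2 * m := ⟨c / 2, by omega⟩
    exact exists_mem_inertia_map_ne_of_sq_eq_mul (m := m) Nat.prime_two (by simpa using h2)
      (by push_cast; omega) (by simpa using hs')
  · exact exists_mem_inertia_map_ne_of_sq_eq_three h2 h hs'

end MovedSquareRoots

section Triples

/-- An integral point `(x, y, z)` of the conic `X ^ 2 - a * Y ^ 2 = b * Z ^ 2` together with square
roots `A` of `a`, `B` of `b` and `R` of `x + y * A` in a field. These square roots generate the
field `F(x, y, z)` of the theorem. -/
structure IsRedeiTriple {L : Type*} [Field L] (a b x y z : ℤ) (A B R : L) : Prop where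
  sq_left : A ^ 2 = a
  sq_right : B ^ 2 = b
  sq_root : R ^ 2 = x + y * A
  norm_eq : x ^ 2 - a * y ^ 2 = b * z ^ 2

namespace IsRedeiTriple

section

variable {L : Type*} [Field L] {a b x y z : ℤ} {A B R : L}

theorem neg_right (h : IsRedeiTriple a b x y z A B R) : IsRedeiTriple a b x y z A (-B) R :=
  { h with sq_right := by rw [neg_sq, h.sq_right] }

theorem cast_norm_eq (h : IsRedeiTriple a b x y z A B R) :
    (x : L) ^ 2 - a * y ^ 2 = b * z ^ 2 := by
  exact_mod_cast congrArg (Int.cast : ℤ → L) h.norm_eq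

-- Both sides of `(x + z√b + y√a)² = 2 (x + y√a) (x + z√b)` agree on the conic.
theorem swap (h : IsRedeiTriple a b x y z A B R) (hR : R ≠ 0) :
    IsRedeiTriple b a (2 * x) (2 * z) (2 * y) B A ((x + z * B + y * A) / R) where
  sq_left := h.sq_right
  sq_right := h.sq_left
  sq_root := by
    rw [div_pow, div_eq_iff (pow_ne_zero 2 hR), h.sq_root]
    push_cast
    linear_combination z ^ 2 * h.sq_right + y ^ 2 * h.sq_left - h.cast_norm_eq
  norm_eq := by linear_combination 4 * h.norm_eq

theorem map_root_eq_of_map_swap_eq {K : Type*} [Field K] [Algebra K L] {σ : Gal(L/K)} [CharZero L]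
    (h : IsRedeiTriple a b x y z A B R) (hσA : σ A = A) (hσB : σ B = B) (hne : x + z * B ≠ 0)
    (hσ : σ ((x + z * B + y * A) / R) = (x + z * B + y * A) / R) : σ R = R := by
  by_cases hR : R = 0
  · rw [hR, map_zero]
  have hsum : x + z * B + y * A ≠ 0 := by
    intro h0
    have hsq := (h.swap hR).sq_root
    rw [h0, zero_div, zero_pow two_ne_zero] at hsq
    push_cast at hsq
    exact mul_ne_zero two_ne_zero hne (by linear_combination -hsq)
  simp only [map_div₀, map_add, map_mul, map_intCast, hσA, hσB] at hσ
  have hσR : σ R ≠ 0 := (map_ne_zero σ).mpr hR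
  field_simp at hσ
  exact hσ.symm

end

section Fixed

variable {K L : Type*} [Field K] [Field L] [NumberField L] [Algebra K L] {P : Ideal (𝓞 L)}
  [hP : P.IsPrime] {σ : Gal(L/K)} {p : ℕ} {a b x y z : ℤ} {A B R : L}

theorem add_mul_notMem_or (h : IsRedeiTriple a b x y z A B R) {A' B' : 𝓞 L} (hA : (A' : L) = A)
    (hB : (B' : L) = B) (hp : p.Prime) (hpP : (p : 𝓞 L) ∈ P) (ha : ¬ (p : ℤ) ∣ a)
    (hb : ¬ (p : ℤ) ∣ b) (hprim : ¬ ((p : ℤ) ∣ x ∧ (p : ℤ) ∣ y ∧ (p : ℤ) ∣ z)) :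
    (x + y * A' : 𝓞 L) ∉ P ∨ (x + z * B' : 𝓞 L) ∉ P := by
  by_contra! hmem
  have hp' := Nat.prime_iff_prime_int.mp hp
  have hdvd (c n : ℤ) (hc : ¬ (p : ℤ) ∣ c) (hn : ((c * n ^ 2 : ℤ) : 𝓞 L) ∈ P) : (p : ℤ) ∣ n :=
    hp'.dvd_of_dvd_pow ((hp'.dvd_or_dvd ((intCast_mem_iff hp hpP _).mp hn)).resolve_left hc)
  have hA2 : A' ^ 2 = a := RingOfIntegers.ext (by simpa [hA] using h.sq_left)
  have hB2 : B' ^ 2 = b := RingOfIntegers.ext (by simpa [hB] using h.sq_right)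
  have hnorm : (x : 𝓞 L) ^ 2 - a * y ^ 2 = b * z ^ 2 := by exact_mod_cast h.norm_eq
  have hz : (p : ℤ) ∣ z := hdvd b z hb <| by
    convert P.mul_mem_right (x - y * A') hmem.1 using 1
    push_cast
    linear_combination -hnorm + y ^ 2 * hA2
  have hy : (p : ℤ) ∣ y := hdvd a y ha <| by
    convert P.mul_mem_right (x - z * B') hmem.2 using 1
    push_cast
    linear_combination -hnorm + z ^ 2 * hB2
  have hx : (x : 𝓞 L) ∈ P :=
    (Ideal.add_mem_iff_left P (P.mul_mem_right A' ((intCast_mem_iff hp hpP y).mpr hy))).mp hmem.1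
  exact hprim ⟨(intCast_mem_iff hp hpP x).mp hx, hy, hz⟩

theorem map_root_eq_of_not_dvd (h : IsRedeiTriple a b x y z A B R) (hp : p.Prime)
    (hpP : (p : 𝓞 L) ∈ P) (h2 : (2 : 𝓞 L) ∉ P) (hσ : σ ∈ P.inertia Gal(L/K)) (hσA : σ A = A)
    (hσB : σ B = B) (ha : ¬ (p : ℤ) ∣ a) (hb : ¬ (p : ℤ) ∣ b)
    (hprim : ¬ ((p : ℤ) ∣ x ∧ (p : ℤ) ∣ y ∧ (p : ℤ) ∣ z)) : σ R = R := by
  by_cases hR : R = 0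
  · rw [hR, map_zero]
  obtain ⟨A', rfl, -⟩ := exists_ringOfIntegers_of_sq_eq_intCast h.sq_left
  obtain ⟨B', rfl, -⟩ := exists_ringOfIntegers_of_sq_eq_intCast h.sq_right
  rcases h.add_mul_notMem_or rfl rfl hp hpP ha hb hprim with hu | hu
  · exact map_eq_of_sq_eq_of_two_notMem h2 hσ hu (by simpa using h.sq_root) (by simp [hσA])
  · refine h.map_root_eq_of_map_swap_eq hσA hσB (fun h0 ↦ hu ?_) <|
      map_eq_of_sq_eq_of_two_notMem h2 hσ (hP.mul_notMem h2 hu) (u := 2 * (x + z * B')) ?_ ?_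
    · rw [show (x + z * B' : 𝓞 L) = 0 from RingOfIntegers.ext (by simpa using h0)]
      exact P.zero_mem
    · rw [(h.swap hR).sq_root]
      simp [map_ofNat]
      ring
    · simp [map_ofNat, hσB]

theorem map_root_eq_of_not_dvd_fst (h : IsRedeiTriple a b x y z A B R) (hp : p.Prime)
    (hpP : (p : 𝓞 L) ∈ P) (h2 : (2 : 𝓞 L) ∉ P) (hσ : σ ∈ P.inertia Gal(L/K)) (hσA : σ A = A)
    (ha : (p : ℤ) ∣ a) (hx : ¬ (p : ℤ) ∣ x) : σ R = R := by
  obtain ⟨A', rfl, hA'⟩ := exists_ringOfIntegers_of_sq_eq_intCast h.sq_left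
  have hA'P : A' ∈ P := hP.mem_of_pow_mem 2 (hA' ▸ (intCast_mem_iff hp hpP a).mpr ha)
  refine map_eq_of_sq_eq_of_two_notMem h2 hσ (u := x + y * A') ?_ (by simpa using h.sq_root)
    (by simp [hσA])
  rwa [Ideal.add_mem_iff_left P (P.mul_mem_left _ hA'P), intCast_mem_iff hp hpP]

theorem map_root_eq_of_sq_not_dvd_fst (h : IsRedeiTriple a b (p * x) (p * y) (p * z) A B R)
    (hp : p.Prime) (hpP : (p : 𝓞 L) ∈ P) (h2 : (2 : 𝓞 L) ∉ P) (hσ : σ ∈ P.inertia Gal(L/K))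
    (hσA : σ A = A) (ha : (p : ℤ) ∣ a) (ha2 : ¬ (p : ℤ) * p ∣ a) (hx : ¬ (p : ℤ) ∣ x) :
    σ R = R := by
  obtain ⟨A', rfl, hA'⟩ := exists_ringOfIntegers_of_sq_eq_intCast h.sq_left
  have hA'P : A' ∈ P := hP.mem_of_pow_mem 2 (hA' ▸ (intCast_mem_iff hp hpP a).mpr ha)
  obtain ⟨c, rfl⟩ := ha
  have hp0 : (p : L) ≠ 0 := by exact_mod_cast hp.ne_zero
  have hc : ¬ (p : ℤ) ∣ c := fun hc ↦ ha2 (mul_dvd_mul_left _ hc)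
  have hsq : (A' : L) ^ 2 = p * c := by simpa using h.sq_left
  have hA'0 : (A' : L) ≠ 0 := by
    rintro h0
    have hc0 : (p * c : L) = 0 := by rw [← hsq, h0, zero_pow two_ne_zero]
    exact hc (by simp [show c = 0 by simpa [hp0] using hc0])
  have hfix : σ (A' * R / p) = A' * R / p := by
    refine map_eq_of_sq_eq_of_two_notMem h2 hσ (u := c * (x + y * A')) (hP.mul_notMem ?_ ?_) ?_
      (by simp [hσA])
    · rwa [intCast_mem_iff hp hpP]
    · rwa [Ideal.add_mem_iff_left P (P.mul_mem_left _ hA'P), intCast_mem_iff hp hpP]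
    · rw [div_pow, mul_pow, hsq, h.sq_root]
      push_cast [map_mul, map_add, map_intCast]
      field_simp
  rw [map_div₀, map_mul, hσA, map_natCast, div_left_inj' hp0] at hfix
  exact mul_left_cancel₀ hA'0 hfix

theorem map_root_eq_of_even_snd (h : IsRedeiTriple a b x y z A B R) (h2 : (2 : 𝓞 L) ∈ P)
    (hσ : σ ∈ P.inertia Gal(L/K)) (hσA : σ A = A) (ha : a % 4 = 1) (hy : y % 2 = 0)
    (hxy : (x - y) % 4 = 1) : σ R = R :=
  map_eq_of_sq_eq_add_mul h2 hσ h.sq_left ha hσA h.sq_root hy hxy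

theorem map_root_eq_of_even_thd (h : IsRedeiTriple a b (2 * x) (2 * y) (2 * z) A B R)
    (h2 : (2 : 𝓞 L) ∈ P) (hσ : σ ∈ P.inertia Gal(L/K)) (hσA : σ A = A) (hσB : σ B = B)
    (hb : b % 4 = 1) (hz : z % 2 = 0) (hxz : (x - z) % 4 = 1) : σ R = R := by
  by_cases hR : R = 0
  · rw [hR, map_zero]
  set G := ((2 * x : ℤ) + (2 * z : ℤ) * B + (2 * y : ℤ) * A) / R
  have hσG : σ (G / 2) = G / 2 := by
    refine map_eq_of_sq_eq_add_mul h2 hσ h.sq_right hb hσB ?_ hz hxz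
    rw [div_pow, (h.swap hR).sq_root]
    push_cast
    ring
  obtain ⟨B', hB', -⟩ := exists_ringOfIntegers_of_sq_eq_intCast h.sq_right
  have hodd : (x + z * B' : 𝓞 L) ∉ P := by
    have h2' : ((2 : ℕ) : 𝓞 L) ∈ P := by simpa using h2
    have hzP := (intCast_mem_iff Nat.prime_two h2' z).mpr (by push_cast; omega)
    rw [Ideal.add_mem_iff_left P (P.mul_mem_right _ hzP), intCast_mem_iff Nat.prime_two h2']
    push_cast
    omega
  refine h.map_root_eq_of_map_swap_eq hσA hσB (fun h0 ↦ hodd ?_) ?_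
  · have h0' : (x + z * B : L) = 0 := by
      refine (mul_eq_zero.mp (?_ : (2 : L) * (x + z * B) = 0)).resolve_left two_ne_zero
      push_cast at h0
      linear_combination h0
    rw [show (x + z * B' : 𝓞 L) = 0 from RingOfIntegers.ext (by simpa [hB'] using h0')]
    exact P.zero_mem
  · rwa [map_div₀, map_ofNat, div_left_inj' two_ne_zero] at hσG

theorem exists_sqrt_eq_add_two_mul (h2 : (2 : 𝓞 L) ∈ P) {B : L} {b w c : ℤ} {k : ℕ}
    (hB : B ^ 2 = b) (hw : w % 2 = 1) (hbw : b - w ^ 2 = 4 ^ (k + 1) * c) :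
    ∃ ν : 𝓞 L, (B = w + 2 * ν ∨ -B = w + 2 * ν) ∧ ν + w ∉ P ∧ ν * (ν + w) = 4 ^ k * c := by
  obtain ⟨v, rfl⟩ : ∃ v, w = 2 * v + 1 := ⟨w / 2, by omega⟩
  have hb : b % 4 = 1 := by
    rw [show b = 4 * (4 ^ k * c + v ^ 2 + v) + 1 by linear_combination hbw]
    omega
  obtain ⟨ω, rfl⟩ := exists_eq_two_mul_sub_one hB hb
  have hprod : (ω - v - 1) * (ω + v) = 4 ^ k * c := RingOfIntegers.ext <| by
    have hbw' : (b : L) - (2 * v + 1) ^ 2 = 4 ^ (k + 1) * c := by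
      exact_mod_cast congrArg (Int.cast : ℤ → L) hbw
    simp only [map_mul, map_sub, map_add, map_one, map_intCast, map_pow, map_ofNat]
    linear_combination (hB + hbw') / 4
  by_cases hmem : ω + v ∈ P
  · refine ⟨-ω - v, .inr ?_, fun hmem' ↦ hP.one_notMem ?_, ?_⟩
    · push_cast [map_sub, map_neg, map_intCast]
      ring
    · convert P.sub_mem (P.add_mem hmem hmem') (P.mul_mem_right (v : 𝓞 L) h2) using 1
      push_cast
      ring
    · push_cast
      linear_combination hprod
  · refine ⟨ω - v - 1, .inl ?_, ?_, ?_⟩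
    · push_cast [map_sub, map_neg, map_intCast, map_one]
      ring
    · rwa [show ω - v - 1 + (2 * v + 1 : ℤ) = ω + v by push_cast; ring]
    · push_cast
      linear_combination hprod

theorem map_root_eq_of_right_eq_add_two_mul (h : IsRedeiTriple a b x y z A B R)
    (h2 : (2 : 𝓞 L) ∈ P) (hσ : σ ∈ P.inertia Gal(L/K)) (hσA : σ A = A) (hσB : σ B = B)
    (hne : x + z * B ≠ 0) {w c e m : ℤ} {k : ℕ} {ν : 𝓞 L} {E : L} (hν : B = w + 2 * ν)
    (hs : ν + w ∉ P) (hνc : ν * (ν + w) = 4 ^ k * c) (hE : E ^ 2 = e) (he : e ≠ 0) (hσE : σ E = E)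
    (hxw : 2 * e * (x + z * w) = 4 ^ k * (4 * m + 1)) : σ R = R := by
  by_cases hR : R = 0
  · rw [hR, map_zero]
  set G := (x + z * B + y * A) / R
  have hE0 : E ≠ 0 := fun h0 ↦ he (by simpa [h0] using hE.symm)
  have hs0 : (ν + w : L) ≠ 0 := fun h0 ↦ hs <| by
    rw [show ν + w = 0 from RingOfIntegers.ext (by simpa using h0)]
    exact P.zero_mem
  have hσν : σ ν = ν := by simpa [hν, map_ofNat] using hσB
  have hGsq : G ^ 2 = 2 * x + 2 * z * B := by simpa using (h.swap hR).sq_root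
  have hνc' : (ν * (ν + w) : L) = 4 ^ k * c := by
    simpa [map_ofNat] using congrArg (algebraMap (𝓞 L) L) hνc
  have hxw' : (2 * e * (x + z * w) : L) = 4 ^ k * (4 * m + 1) := by
    exact_mod_cast congrArg (Int.cast : ℤ → L) hxw
  -- `s = ν + w` is a unit at `P`, and `(s * G * E / 2 ^ k) ^ 2` is `s ^ 2` modulo `4`.
  have hfix : σ ((ν + w) * (G * E) / 2 ^ k) = (ν + w) * (G * E) / 2 ^ k := by
    refine map_eq_of_sq_eq_sq_add_four_mul h2 hσ (s := ν + w)
      (e := (ν + w) ^ 2 * m + (ν + w) * e * z * c) hs ?_ (by simp [hσν]) (by simp [hσν])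
    rw [div_pow, ← pow_mul, mul_comm k, pow_mul, show (2 : L) ^ 2 = 4 by norm_num,
      div_eq_iff (pow_ne_zero k (by norm_num))]
    simp only [map_add, map_mul, map_pow, map_intCast]
    rw [mul_pow, mul_pow, hGsq, hE, hν]
    linear_combination (ν + w : L) ^ 2 * hxw' + 4 * e * z * (ν + w : L) * hνc'
  have h2k : (2 : L) ^ k ≠ 0 := pow_ne_zero k two_ne_zero
  refine h.map_root_eq_of_map_swap_eq hσA hσB hne ?_
  simp only [map_div₀, map_mul, map_add, map_intCast, map_pow, map_ofNat, hσν, hσE] at hfix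
  exact mul_right_cancel₀ hE0 (mul_left_cancel₀ hs0 ((div_left_inj' h2k).mp hfix))

theorem add_mul_right_ne_zero (h : IsRedeiTriple a b x y z A B R) (ha : a ≠ 0) (hy : y ≠ 0) :
    x + z * B ≠ 0 := by
  intro h0
  have hay : (a * y ^ 2 : L) ≠ 0 := by exact_mod_cast mul_ne_zero ha (pow_ne_zero 2 hy)
  refine hay ?_
  linear_combination (x - z * B) * h0 - h.cast_norm_eq + z ^ 2 * h.sq_right

theorem map_root_eq_of_split (h : IsRedeiTriple a b x y z A B R) (h2 : (2 : 𝓞 L) ∈ P)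
    (hσ : σ ∈ P.inertia Gal(L/K)) (hσA : σ A = A) (hσB : σ B = B) (ha : a ≠ 0) (hy : y ≠ 0)
    {w c e m : ℤ} {k : ℕ} {E : L} (hw : w % 2 = 1) (hbw : b - w ^ 2 = 4 ^ (k + 1) * c)
    (hE : E ^ 2 = e) (he : e ≠ 0) (hσE : σ E = E)
    (hxw : 2 * e * (x + z * w) = 4 ^ k * (4 * m + 1)) : σ R = R := by
  obtain ⟨ν, hν | hν, hs, hνc⟩ := exists_sqrt_eq_add_two_mul h2 h.sq_right hw hbw
  · exact h.map_root_eq_of_right_eq_add_two_mul h2 hσ hσA hσB (h.add_mul_right_ne_zero ha hy) hν hs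
      hνc hE he hσE hxw
  · exact h.neg_right.map_root_eq_of_right_eq_add_two_mul h2 hσ hσA (by rw [map_neg, hσB])
      (h.neg_right.add_mul_right_ne_zero ha hy) hν hs hνc hE he hσE hxw

end Fixed

end IsRedeiTriple

end Triples

section Frobenius

open scoped commutatorElement Pointwise

theorem exists_isPrime_natCast_mem (L : Type*) [Field L] [NumberField L] {p : ℕ} (hp : p.Prime) :
    ∃ P : Ideal (𝓞 L), P.IsPrime ∧ (p : 𝓞 L) ∈ P := by
  have : Fact p.Prime := ⟨hp⟩
  have : (Ideal.span {(p : ℤ)}).IsMaximal := Int.ideal_span_isMaximal_of_prime p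
  obtain ⟨⟨P, hP, hover⟩⟩ := (Ideal.span {(p : ℤ)}).nonempty_primesOver (S := 𝓞 L)
  refine ⟨P, hP, ?_⟩
  simpa using (Ideal.mem_of_liesOver P _ (p : ℤ)).mp (Ideal.mem_span_singleton_self _)

variable {L : Type*} [Field L] [NumberField L] {P : Ideal (𝓞 L)}

theorem commutator_mem_inertia {σ τ : Gal(L/ℚ)} (hσ : σ ∈ P.inertia Gal(L/ℚ))
    (hτ : IsArithFrobAt ℤ τ P) : ⁅σ, τ⁆ ∈ P.inertia Gal(L/ℚ) := by
  have hconj := hτ.conj σ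
  rw [show σ • P = P from Ideal.inertia_le_stabilizer P hσ] at hconj
  exact hconj.mul_inv_mem_inertia hτ

variable [hP : P.IsPrime]

theorem smul_sub_pow_mem_of_isArithFrobAt {p : ℕ} (hp : p.Prime) (hpP : (p : 𝓞 L) ∈ P)
    {τ : Gal(L/ℚ)} (hτ : IsArithFrobAt ℤ τ P) (x : 𝓞 L) : τ • x - x ^ p ∈ P := by
  have hunder : P.under ℤ = Ideal.span {(p : ℤ)} := by
    ext n
    rw [Ideal.mem_comap, Ideal.mem_span_singleton, eq_intCast, intCast_mem_iff hp hpP]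
  have hcard : Nat.card (ℤ ⧸ P.under ℤ) = p := by
    rw [hunder, Nat.card_congr (Int.quotientSpanNatEquivZMod p).toEquiv, Nat.card_zmod]
  have hx := hτ x
  rwa [hcard] at hx

theorem map_ne_of_isArithFrobAt (h2 : (2 : 𝓞 L) ∈ P) {τ : Gal(L/ℚ)} (hτ : IsArithFrobAt ℤ τ P)
    {B : L} {b : ℤ} (hb : b % 8 = 5) (hB : B ^ 2 = b) : τ B ≠ B := by
  intro hτB
  obtain ⟨k, rfl⟩ : ∃ k, b = 8 * k + 5 := ⟨b / 8, by omega⟩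
  obtain ⟨ω, rfl⟩ := exists_eq_two_mul_sub_one hB (by omega)
  have hτω : τ ω = ω := by simpa [map_ofNat] using hτB
  have hdiff : τ • ω - ω ^ 2 = ((-(2 * k + 1) : ℤ) : 𝓞 L) := RingOfIntegers.ext <| by
    change τ ω - (ω : L) ^ 2 = ((-(2 * k + 1) : ℤ) : L)
    rw [hτω]
    push_cast at hB ⊢
    linear_combination -hB / 4
  have hmem := smul_sub_pow_mem_of_isArithFrobAt Nat.prime_two (by simpa using h2) hτ ω
  rw [hdiff, intCast_mem_iff Nat.prime_two (by simpa using h2)] at hmem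
  push_cast at hmem
  omega

theorem commutator_map_eq_of_sq_eq {K L : Type*} [Field K] [Field L] [Algebra K L]
    (σ τ : Gal(L/K)) {s : L} {n : ℤ} (hs : s ^ 2 = n) : ⁅σ, τ⁆ s = s := by
  obtain ⟨u, rfl⟩ := (τ * σ).surjective s
  have hu : u ^ 2 = n := (τ * σ).injective (by rw [map_pow, hs, map_intCast])
  have hsign (ρ : Gal(L/K)) : ρ u = u ∨ ρ u = -u := map_eq_or_eq_neg_of_sq (by simp [hu])
  have hcomm : σ (τ u) = τ (σ u) := by
    rcases hsign σ with h | h <;> rcases hsign τ with h' | h' <;> simp [h, h']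
  simpa [commutatorElement_def] using hcomm

theorem exists_isArithFrobAt [IsGalois ℚ L] {p : ℕ} (hp : p ≠ 0) (hpP : (p : 𝓞 L) ∈ P) :
    ∃ τ : Gal(L/ℚ), IsArithFrobAt ℤ τ P := by
  have : Finite (𝓞 L ⧸ P) := Ring.HasFiniteQuotients.finiteQuotient (ne_bot_of_natCast_mem hp hpP)
  have := IsGaloisGroup.of_isFractionRing Gal(L/ℚ) ℤ (𝓞 L) ℚ L
  exact IsArithFrobAt.exists_of_isInvariant ℤ Gal(L/ℚ) P

namespace IsRedeiTriple

theorem commutator_ne_one {K L : Type*} [Field K] [Field L] [CharZero L] [Algebra K L]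
    {a b x y z : ℤ} {A B R : L} (h : IsRedeiTriple a b x y z A B R) (hR : R ≠ 0) (ha : a ≠ 0)
    (hy : y ≠ 0) {σ τ : Gal(L/K)} (hσA : σ A = -A) (hσB : σ B = B) (hτB : τ B = -B) :
    ⁅σ, τ⁆ ≠ 1 := by
  intro hone
  have hcomm : σ * τ = τ * σ := commutatorElement_eq_one_iff_mul_comm.mp hone
  have hA0 : A ≠ 0 := fun h0 ↦ ha (by simpa [h0] using h.sq_left.symm)
  have hyA : 2 * y * A ≠ 0 := by simp [hy, hA0]
  -- `G * τ G = ± 2 * y * A` is negated by `σ`, but fixed if `σ` and `τ` commute as `σ G = ± G`.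
  set G := (x + z * B + y * A) / R
  have hG : G ^ 2 = 2 * x + 2 * z * B := by simpa using (h.swap hR).sq_root
  have hprod : (G * τ G) ^ 2 = (2 * y * A) ^ 2 := by
    rw [mul_pow, ← map_pow, hG]
    simp only [map_add, map_mul, map_ofNat, map_intCast, hτB]
    linear_combination 4 * h.cast_norm_eq - 4 * y ^ 2 * h.sq_left - 4 * z ^ 2 * h.sq_right
  have hprod0 : G * τ G ≠ 0 := (pow_ne_zero_iff two_ne_zero).mp (hprod ▸ pow_ne_zero 2 hyA)
  have hneg : σ (G * τ G) = -(G * τ G) := by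
    rcases sq_eq_sq_iff_eq_or_eq_neg.mp hprod with h' | h' <;> simp [h', hσA, map_ofNat]
  have hfix : σ (G * τ G) = G * τ G := by
    have hστ : σ (τ G) = τ (σ G) := DFunLike.congr_fun hcomm G
    rcases map_eq_or_eq_neg_of_sq (σ := σ) (θ := G) (by simp [hG, hσB, map_ofNat]) with h' | h' <;>
      simp [hστ, h']
  exact hprod0 (self_eq_neg.mp (hfix.symm.trans hneg))

variable {a b x y z : ℤ} {A B R : L}

theorem exists_mem_inertia_ne_one [IsGalois ℚ L] (h : IsRedeiTriple a b x y z A B R)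
    (h2 : (2 : 𝓞 L) ∈ P) (hR : R ≠ 0) (hy : y ≠ 0) (ha : a % 4 = 3) (hb : b % 8 = 5) :
    ∃ ρ ∈ P.inertia Gal(L/ℚ), ρ A = A ∧ ρ B = B ∧ ρ ≠ 1 := by
  obtain ⟨σ, hσ, hσA⟩ := exists_mem_inertia_map_ne_of_sq_eq_three h2 ha h.sq_left
  obtain ⟨τ, hτ⟩ := exists_isArithFrobAt two_ne_zero (by simpa using h2)
  have hτB := map_ne_of_isArithFrobAt h2 hτ hb h.sq_right
  have hsign {ρ : Gal(L/ℚ)} {s : L} {n : ℤ} (hs : s ^ 2 = n) (hne : ρ s ≠ s) : ρ s = -s :=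
    (map_eq_or_eq_neg_of_sq (by simp [hs])).resolve_left hne
  exact ⟨⁅σ, τ⁆, commutator_mem_inertia hσ hτ, commutator_map_eq_of_sq_eq σ τ h.sq_left,
    commutator_map_eq_of_sq_eq σ τ h.sq_right, h.commutator_ne_one hR (by omega) hy
      (hsign h.sq_left hσA) (map_eq_of_sq_eq_intCast h2 hσ h.sq_right (by omega))
      (hsign h.sq_right hτB)⟩

end IsRedeiTriple

end Frobenius

section Generators

variable {K L : Type*} [Field K] [Field L] [NumberField L] [Algebra K L] {p : ℕ}

theorem unramifiedOver_of_closure_eq_top [NumberField K] [IsGalois K L] {S : Set L}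
    (hS : Subfield.closure S = ⊤) (hp : p ≠ 0)
    (hfix : ∀ P : Ideal (𝓞 L), P.IsPrime → (p : 𝓞 L) ∈ P →
      ∀ σ ∈ P.inertia Gal(L/K), ∀ x ∈ S, σ x = x) : UnramifiedOver K L p := by
  rw [unramifiedOver_iff_inertia_eq_bot hp]
  intro P hP hpP
  rw [Subgroup.eq_bot_iff_forall]
  intro σ hσ
  have hid : (σ : L →+* L) = RingHom.id L :=
    RingHom.eq_of_eqOn_of_field_closure_eq_top hS fun x hx ↦ hfix P hP hpP σ hσ x hx
  exact AlgEquiv.ext fun x ↦ DFunLike.congr_fun hid x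

theorem exists_algEquiv_of_closure_eq_top {S : Set K} (hS : Subfield.closure S = ⊤)
    {σ : Gal(L/ℚ)} (hσ : ∀ x ∈ S, σ (algebraMap K L x) = algebraMap K L x) :
    ∃ σ' : Gal(L/K), ∀ x, σ' x = σ x := by
  have hcomp : (σ : L →+* L).comp (algebraMap K L) = algebraMap K L :=
    RingHom.eq_of_eqOn_of_field_closure_eq_top hS hσ
  exact ⟨AlgEquiv.ofRingEquiv (f := (σ : L ≃+* L)) fun x ↦ DFunLike.congr_fun hcomp x,
    fun _ ↦ rfl⟩

theorem UnramifiedOver.eq_one_of_mem_inertia [NumberField K] [IsGalois K L]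
    (h : UnramifiedOver K L p) (hp : p ≠ 0) {S : Set K} (hS : Subfield.closure S = ⊤)
    {P : Ideal (𝓞 L)} [P.IsPrime] (hpP : (p : 𝓞 L) ∈ P) {σ : Gal(L/ℚ)}
    (hσ : σ ∈ P.inertia Gal(L/ℚ))
    (hσS : ∀ x ∈ S, σ (algebraMap K L x) = algebraMap K L x) : σ = 1 := by
  obtain ⟨σ', hσ'⟩ := exists_algEquiv_of_closure_eq_top hS hσS
  have hmem : σ' ∈ P.inertia Gal(L/K) := fun x ↦ by
    rw [show σ' • x = σ • x from RingOfIntegers.ext (hσ' x)]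
    exact hσ x
  rw [(unramifiedOver_iff_inertia_eq_bot hp).mp h P inferInstance hpP, Subgroup.mem_bot] at hmem
  exact AlgEquiv.ext fun x ↦ by rw [← hσ', hmem, AlgEquiv.one_apply, AlgEquiv.one_apply]

end Generators

section SquareClasses

variable {L : Type*} [Field L] [NumberField L] [IsGalois ℚ L]

theorem UnramifiedOver.map_eq_of_mem_inertia_rat {p : ℕ} (h : UnramifiedOver ℚ L p) (hp : p ≠ 0)
    {P : Ideal (𝓞 L)} [P.IsPrime] (hpP : (p : 𝓞 L) ∈ P) {σ : Gal(L/ℚ)}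
    (hσ : σ ∈ P.inertia Gal(L/ℚ)) (x : L) : σ x = x :=
  h.map_eq_of_mem_inertia hp (AlgHom.id ℚ L) hpP hσ x

theorem UnramifiedOver.sq_ne_mul {p : ℕ} (h : UnramifiedOver ℚ L p) (hp : p.Prime) {m : ℤ}
    (hm : ¬ (p : ℤ) ∣ m) (s : L) : s ^ 2 ≠ p * m := by
  intro hs
  obtain ⟨P, hP, hpP⟩ := exists_isPrime_natCast_mem L hp
  obtain ⟨σ, hσ, hne⟩ := exists_mem_inertia_map_ne_of_sq_eq_mul hp hpP hm hs
  exact hne (h.map_eq_of_mem_inertia_rat hp.ne_zero hpP hσ s)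

theorem UnramifiedOver.isFourPowMulOneMod (h : UnramifiedOver ℚ L 2) {s : L} {n : ℤ} (hn : n ≠ 0)
    (hs : s ^ 2 = n) : IsFourPowMulOneMod n := by
  by_contra hnU
  obtain ⟨P, hP, h2⟩ := exists_isPrime_natCast_mem L Nat.prime_two
  obtain ⟨σ, hσ, hne⟩ :=
    exists_mem_inertia_map_ne_of_not_isFourPowMulOneMod (by simpa using h2) hn hnU hs
  exact hne (h.map_eq_of_mem_inertia_rat two_ne_zero h2 hσ s)

theorem isFourPowMulOneMod_or_mul_of_forall_mem_inertia {P : Ideal (𝓞 L)} [P.IsPrime]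
    (h2 : (2 : 𝓞 L) ∈ P) {A S : L} {a r : ℤ} (hA : A ^ 2 = a) (hS : S ^ 2 = r) (ha : a ≠ 0)
    (hr : r ≠ 0) (h : ∀ σ ∈ P.inertia Gal(L/ℚ), σ A = A → σ S = S) :
    IsFourPowMulOneMod r ∨ IsFourPowMulOneMod (r * a) := by
  by_contra! hcon
  have hsign {x : L} {n : ℤ} (hx : x ^ 2 = n) {σ : Gal(L/ℚ)} (hne : σ x ≠ x) : σ x = -x :=
    (map_eq_or_eq_neg_of_sq (by simp [hx])).resolve_left hne
  obtain ⟨σ, hσ, hσS⟩ := exists_mem_inertia_map_ne_of_not_isFourPowMulOneMod h2 hr hcon.1 hS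
  obtain ⟨τ, hτ, hτSA⟩ := exists_mem_inertia_map_ne_of_not_isFourPowMulOneMod h2 (s := S * A)
    (mul_ne_zero hr ha) hcon.2 (by rw [mul_pow, hS, hA, Int.cast_mul])
  have hσA : σ A = -A := hsign hA (mt (h σ hσ) hσS)
  have hτA : τ A = -A := hsign hA fun hfix ↦ hτSA (by rw [map_mul, h τ hτ hfix, hfix])
  have hτS : τ S = S := by
    by_contra hne
    exact hτSA (by rw [map_mul, hsign hS hne, hτA, neg_mul_neg])
  refine hσS ?_
  have hστ := h (σ * τ) (mul_mem hσ hτ) (by rw [AlgEquiv.mul_apply, hτA, map_neg, hσA, neg_neg])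
  rwa [AlgEquiv.mul_apply, hτS] at hστ

variable {K : Type*} [Field K] [NumberField K] [Algebra K L] [IsGalois K L] {A B : L} {a b : ℤ}
  {s : K}

theorem UnramifiedOver.isFourPowMulOneMod_or_mul (h : UnramifiedOver K L 2)
    (hs : Subfield.closure {s} = ⊤) (hsAB : algebraMap K L s = A * B) (hA : A ^ 2 = a)
    (hB : B ^ 2 = b) (ha : a ≠ 0) (hb : b % 4 = 1) {S : L} {r : ℤ} (hS : S ^ 2 = r) (hr : r ≠ 0) :
    IsFourPowMulOneMod r ∨ IsFourPowMulOneMod (r * a) := by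
  obtain ⟨P, hP, h2⟩ := exists_isPrime_natCast_mem L Nat.prime_two
  have h2' : (2 : 𝓞 L) ∈ P := by simpa using h2
  refine isFourPowMulOneMod_or_mul_of_forall_mem_inertia h2' hA hS ha hr fun σ hσ hσA ↦ ?_
  have hσB : σ B = B := map_eq_of_sq_eq_intCast h2' hσ hB hb
  rw [h.eq_one_of_mem_inertia two_ne_zero hs h2 hσ (by simp [hsAB, hσA, hσB]), AlgEquiv.one_apply]

theorem IsRedeiTriple.not_unramifiedOver {x y z : ℤ} {R : L} (h : IsRedeiTriple a b x y z A B R)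
    (hs : Subfield.closure {s} = ⊤) (hsAB : algebraMap K L s = A * B) (hR : R ≠ 0) (hy : y ≠ 0)
    (ha : a % 4 = 3) (hb : b % 8 = 5) : ¬ UnramifiedOver K L 2 := by
  intro hunr
  obtain ⟨P, hP, h2⟩ := exists_isPrime_natCast_mem L Nat.prime_two
  obtain ⟨ρ, hρ, hρA, hρB, hne⟩ :=
    h.exists_mem_inertia_ne_one (by simpa using h2) hR hy ha hb
  exact hne (hunr.eq_one_of_mem_inertia two_ne_zero hs h2 hρ (by simp [hsAB, hρA, hρB]))

end SquareClasses

section ComplexFields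

theorem mem_of_sq_eq_sq {k Ω : Type*} [Field k] [Field Ω] [Algebra k Ω]
    {M : IntermediateField k Ω} {v w : Ω} (hv : v ∈ M) (h : w ^ 2 = v ^ 2) : w ∈ M := by
  rcases sq_eq_sq_iff_eq_or_eq_neg.mp h with rfl | rfl
  exacts [hv, neg_mem hv]

theorem mem_sqrtField {c : ℤ} {s : ℂ} (hs : s ^ 2 = c) : s ∈ sqrtField c :=
  IntermediateField.subset_adjoin ℚ _ hs

theorem sqrtField_le {c : ℤ} {s : ℂ} (hs : s ^ 2 = c) {M : IntermediateField ℚ ℂ} (hM : s ∈ M) :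
    sqrtField c ≤ M :=
  IntermediateField.adjoin_le_iff.mpr fun _ hw ↦ mem_of_sq_eq_sq hM (Eq.trans hw hs.symm)

theorem closure_eq_top_of_forall_le {F : IntermediateField ℚ ℂ} {S : Set F}
    (h : ∀ M : IntermediateField ℚ ℂ, (∀ x ∈ S, (x : ℂ) ∈ M) → F ≤ M) :
    Subfield.closure S = ⊤ := by
  let T : Subfield ℂ := (Subfield.closure S).map F.val.toRingHom
  have hF : F ≤ T.toIntermediateField fun q ↦ SubfieldClass.ratCast_mem T q :=
    h _ fun x hx ↦ ⟨x, Subfield.subset_closure hx, rfl⟩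
  refine top_unique fun x _ ↦ ?_
  obtain ⟨y, hy, hyx⟩ := hF x.2
  rwa [← Subtype.ext hyx]

theorem exists_sqrt_closure_eq_top {c : ℤ} {s : ℂ} (hs : s ^ 2 = c) :
    ∃ S : sqrtField c, (S : ℂ) = s ∧ Subfield.closure {S} = ⊤ :=
  ⟨⟨s, mem_sqrtField hs⟩, rfl, closure_eq_top_of_forall_le fun _ hM ↦ sqrtField_le hs (hM _ rfl)⟩

theorem numberField_and_isGalois_of_eq_adjoin_rootSet {F : IntermediateField ℚ ℂ} {q : Polynomial ℚ}
    (h : F = IntermediateField.adjoin ℚ (q.rootSet ℂ)) : NumberField F ∧ IsGalois ℚ F := by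
  subst h
  have : q.IsSplittingField ℚ (IntermediateField.adjoin ℚ (q.rootSet ℂ)) := by
    convert IntermediateField.adjoin_rootSet_isSplittingField (K := ℚ) (L := ℂ) (p := q)
      (IsAlgClosed.splits _)
    exact Subsingleton.elim _ _
  have := Polynomial.IsSplittingField.finiteDimensional
    (IntermediateField.adjoin ℚ (q.rootSet ℂ)) q
  have := Normal.of_isSplittingField (E := IntermediateField.adjoin ℚ (q.rootSet ℂ)) q
  exact ⟨⟨⟩, ⟨⟩⟩

theorem isGalois_sup {k Ω : Type*} [Field k] [Field Ω] [Algebra k Ω] (E F : IntermediateField k Ω)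
    [IsGalois k E] [IsGalois k F] : IsGalois k ↥(E ⊔ F) where

variable {E F : IntermediateField ℚ ℂ} (hE : E ≤ F)

theorem numberField_extendScalars [h : NumberField F] :
    NumberField (IntermediateField.extendScalars hE) :=
  h

theorem isGalois_rat_extendScalars [h : IsGalois ℚ F] :
    IsGalois ℚ (IntermediateField.extendScalars hE) :=
  h

theorem isGalois_extendScalars [IsGalois ℚ F] :
    IsGalois E (IntermediateField.extendScalars hE) :=
  have := isGalois_rat_extendScalars hE
  .tower_top_of_isGalois ℚ E _

end ComplexFields

section RedeiFields

variable {a b x y z : ℤ} {α β γ : ℂ}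

theorem exists_isRedeiTriple (hα : α ^ 2 = a) (heq : x ^ 2 - a * y ^ 2 = b * z ^ 2) :
    ∃ β γ : ℂ, IsRedeiTriple a b x y z α β γ := by
  obtain ⟨β, hβ⟩ := IsAlgClosed.exists_pow_nat_eq (b : ℂ) two_pos
  obtain ⟨γ, hγ⟩ := IsAlgClosed.exists_pow_nat_eq (x + y * α : ℂ) two_pos
  exact ⟨β, γ, hα, hβ, hγ, heq⟩

namespace IsRedeiTriple

theorem left_mem_extField (h : IsRedeiTriple a b x y z α β γ) : α ∈ extField a b α x y :=
  SetLike.le_def.mp (le_sup_of_le_left le_sup_left) (mem_sqrtField h.sq_left)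

theorem right_mem_extField (h : IsRedeiTriple a b x y z α β γ) : β ∈ extField a b α x y :=
  SetLike.le_def.mp (le_sup_of_le_left le_sup_right) (mem_sqrtField h.sq_right)

theorem root_mem_extField (h : IsRedeiTriple a b x y z α β γ) : γ ∈ extField a b α x y :=
  SetLike.le_def.mp le_sup_right
    (IntermediateField.subset_adjoin ℚ _ (by simpa using h.sq_root))

theorem extField_le (h : IsRedeiTriple a b x y z α β γ) {M : IntermediateField ℚ ℂ} (hα : α ∈ M)
    (hβ : β ∈ M) (hγ : γ ∈ M) : extField a b α x y ≤ M := by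
  refine sup_le (sup_le (sqrtField_le h.sq_left hα) (sqrtField_le h.sq_right hβ)) ?_
  refine IntermediateField.adjoin_le_iff.mpr fun w hw ↦ mem_of_sq_eq_sq hγ ?_
  rw [h.sq_root]
  simpa using hw

theorem exists_lift (h : IsRedeiTriple a b x y z α β γ) :
    ∃ A B R : extField a b α x y, (A : ℂ) = α ∧ (B : ℂ) = β ∧ (R : ℂ) = γ ∧
      IsRedeiTriple a b x y z A B R ∧ Subfield.closure {A, B, R} = ⊤ := by
  refine ⟨⟨α, h.left_mem_extField⟩, ⟨β, h.right_mem_extField⟩, ⟨γ, h.root_mem_extField⟩, rfl, rfl,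
    rfl, ⟨Subtype.ext ?_, Subtype.ext ?_, Subtype.ext ?_, h.norm_eq⟩,
    closure_eq_top_of_forall_le fun M hM ↦
      h.extField_le (hM _ (.inl rfl)) (hM _ (.inr (.inl rfl))) (hM _ (.inr (.inr rfl)))⟩
  · simpa using h.sq_left
  · simpa using h.sq_right
  · simpa using h.sq_root

open Polynomial in
theorem exists_extField_eq_adjoin_rootSet (h : IsRedeiTriple a b x y z α β γ) (hγ : γ ≠ 0) :
    ∃ q : ℚ[X], extField a b α x y = IntermediateField.adjoin ℚ (q.rootSet ℂ) := by
  let q : ℚ[X] := (X ^ 2 - C (a : ℚ)) * (X ^ 2 - C (b : ℚ)) *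
    ((X ^ 2 - C (x : ℚ)) ^ 2 - C (a * y ^ 2 : ℚ))
  have hq : q.Monic := ((by monicity! : Monic _).mul (by monicity!)).mul (by monicity!)
  have hroot (w : ℂ) : w ∈ q.rootSet ℂ ↔
      (w ^ 2 - α ^ 2) * (w ^ 2 - β ^ 2) * ((w ^ 2 - γ ^ 2) * (w ^ 2 - (z * β / γ) ^ 2)) = 0 := by
    rw [mem_rootSet, and_iff_right hq.ne_zero]
    have hδ : (z * β / γ) ^ 2 = x - y * α := by
      rw [div_pow, div_eq_iff (pow_ne_zero 2 hγ), h.sq_root]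
      linear_combination (z : ℂ) ^ 2 * h.sq_right + y ^ 2 * h.sq_left - h.cast_norm_eq
    have hw : aeval w q = (w ^ 2 - a) * (w ^ 2 - b) * ((w ^ 2 - x) ^ 2 - a * y ^ 2) := by
      simp [q]
    rw [hw, hδ, h.sq_root, h.sq_left, h.sq_right, ← h.sq_left]
    ring_nf
  refine ⟨q, le_antisymm ?_ (IntermediateField.adjoin_le_iff.mpr fun w hw ↦ ?_)⟩
  · refine h.extField_le ?_ ?_ ?_ <;>
      exact IntermediateField.subset_adjoin ℚ _ ((hroot _).mpr (by ring))
  · have hw' := (hroot w).mp hw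
    simp only [mul_eq_zero, sub_eq_zero] at hw'
    rcases hw' with (hw | hw) | hw | hw
    · exact mem_of_sq_eq_sq h.left_mem_extField hw
    · exact mem_of_sq_eq_sq h.right_mem_extField hw
    · exact mem_of_sq_eq_sq h.root_mem_extField hw
    · exact mem_of_sq_eq_sq (div_mem (mul_mem (intCast_mem _ z) h.right_mem_extField)
        h.root_mem_extField) hw

theorem numberField_extField (h : IsRedeiTriple a b x y z α β γ) (hγ : γ ≠ 0) :
    NumberField (extField a b α x y) := by
  obtain ⟨q, hq⟩ := h.exists_extField_eq_adjoin_rootSet hγ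
  exact (numberField_and_isGalois_of_eq_adjoin_rootSet hq).1

theorem isGalois_extField (h : IsRedeiTriple a b x y z α β γ) (hγ : γ ≠ 0) :
    IsGalois ℚ (extField a b α x y) := by
  obtain ⟨q, hq⟩ := h.exists_extField_eq_adjoin_rootSet hγ
  exact (numberField_and_isGalois_of_eq_adjoin_rootSet hq).2

theorem exists_lift_overK (h : IsRedeiTriple a b x y z α β γ) :
    ∃ (A B R : extFieldOverK a b α x y) (s : sqrtField (a * b)), IsRedeiTriple a b x y z A B R ∧
      Subfield.closure {A, B, R} = ⊤ ∧ (R : ℂ) = γ ∧ algebraMap _ _ s = A * B ∧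
      Subfield.closure {s} = ⊤ := by
  obtain ⟨A, B, R, hA, hB, hR, hABR, hgen⟩ := h.exists_lift
  obtain ⟨s, hs, hsgen⟩ := exists_sqrt_closure_eq_top (c := a * b) (s := α * β)
    (by rw [mul_pow, h.sq_left, h.sq_right, Int.cast_mul])
  exact ⟨A, B, R, s, hABR, hgen, hR,
    Subtype.ext (hs.trans (congrArg₂ (· * ·) hA.symm hB.symm)), hsgen⟩

end IsRedeiTriple

end RedeiFields

section OddInertia

variable {K L : Type*} [Field K] [Field L] [NumberField L] [Algebra K L] {P : Ideal (𝓞 L)}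
  [hP : P.IsPrime] {σ : Gal(L/K)} {p : ℕ}

theorem two_notMem_of_natCast_mem (hp : p.Prime) (hp2 : p ≠ 2) (hpP : (p : 𝓞 L) ∈ P) :
    (2 : 𝓞 L) ∉ P := by
  have h := (intCast_mem_iff hp hpP 2).not.mpr <| by
    exact_mod_cast (Nat.prime_dvd_prime_iff_eq hp Nat.prime_two).not.mpr hp2
  simpa using h

theorem map_eq_of_sq_eq_intCast_of_not_dvd (hp : p.Prime) (hp2 : p ≠ 2) (hpP : (p : 𝓞 L) ∈ P)
    (hσ : σ ∈ P.inertia Gal(L/K)) {s : L} {n : ℤ} (hn : ¬ (p : ℤ) ∣ n) (hs : s ^ 2 = n) :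
    σ s = s :=
  map_eq_of_sq_eq_of_two_notMem (two_notMem_of_natCast_mem hp hp2 hpP) hσ (u := n)
    (by rwa [intCast_mem_iff hp hpP]) (by simpa using hs) (by simp)

end OddInertia

section UnramifiedTriples

variable {K L : Type*} [Field K] [Field L] [Algebra K L] {p : ℕ} {a b x y z : ℤ} {A B R : L}

theorem map_left_eq_of_map_right_eq {σ : Gal(L/K)} {s : K} (hs : algebraMap K L s = A * B)
    (hB : B ≠ 0) (hσB : σ B = B) : σ A = A := by
  have h : σ (A * B) = A * B := by rw [← hs, σ.commutes]
  rwa [map_mul, hσB, mul_left_inj' hB] at h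

theorem not_dvd_fst_of_norm_eq (hp : p.Prime) (heq : x ^ 2 - a * y ^ 2 = b * z ^ 2)
    (ha : (p : ℤ) ∣ a) (ha2 : ¬ (p : ℤ) * p ∣ a) (hb : ¬ (p : ℤ) ∣ b)
    (hprim : ¬ ((p : ℤ) ∣ x ∧ (p : ℤ) ∣ y ∧ (p : ℤ) ∣ z)) : ¬ (p : ℤ) ∣ x := by
  have hpZ : Prime (p : ℤ) := Nat.prime_iff_prime_int.mp hp
  intro hx
  have hz : (p : ℤ) ∣ z := by
    have hbz : (p : ℤ) ∣ b * z ^ 2 := heq ▸ dvd_sub (dvd_pow hx two_ne_zero) (ha.mul_right _)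
    exact hpZ.dvd_of_dvd_pow ((hpZ.dvd_or_dvd hbz).resolve_left hb)
  have hay : (p : ℤ) ^ 2 ∣ a * y ^ 2 := by
    rw [show a * y ^ 2 = x ^ 2 - b * z ^ 2 by linarith]
    exact dvd_sub (pow_dvd_pow_of_dvd hx 2) ((pow_dvd_pow_of_dvd hz 2).mul_left b)
  obtain ⟨c, rfl⟩ := ha
  rw [sq, mul_assoc, mul_dvd_mul_iff_left hpZ.ne_zero] at hay
  have hc : ¬ (p : ℤ) ∣ c := fun hc ↦ ha2 (mul_dvd_mul_left _ hc)
  exact hprim ⟨hx, hpZ.dvd_of_dvd_pow ((hpZ.dvd_or_dvd hay).resolve_left hc), hz⟩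

namespace IsRedeiTriple

theorem right_ne_zero [CharZero L] (h : IsRedeiTriple a b x y z A B R) (hb : b ≠ 0) : B ≠ 0 := by
  rintro rfl
  exact hb (by exact_mod_cast h.sq_right.symm.trans (zero_pow two_ne_zero))

variable [NumberField K] [NumberField L] [IsGalois K L]

theorem unramifiedOver_of_not_dvd (h : IsRedeiTriple a b x y z A B R)
    (hgen : Subfield.closure {A, B, R} = ⊤) (hp : p.Prime) (hp2 : p ≠ 2) (ha : ¬ (p : ℤ) ∣ a)
    (hb : ¬ (p : ℤ) ∣ b) (hprim : ¬ ((p : ℤ) ∣ x ∧ (p : ℤ) ∣ y ∧ (p : ℤ) ∣ z)) :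
    UnramifiedOver K L p := by
  refine unramifiedOver_of_closure_eq_top hgen hp.ne_zero fun P hP hpP σ hσ ↦ ?_
  have hσA : σ A = A := map_eq_of_sq_eq_intCast_of_not_dvd hp hp2 hpP hσ ha h.sq_left
  have hσB : σ B = B := map_eq_of_sq_eq_intCast_of_not_dvd hp hp2 hpP hσ hb h.sq_right
  rintro _ (rfl | rfl | rfl)
  exacts [hσA, hσB, h.map_root_eq_of_not_dvd hp hpP (two_notMem_of_natCast_mem hp hp2 hpP) hσ hσA
    hσB ha hb hprim]

theorem unramifiedOver_of_even_snd (h : IsRedeiTriple a b x y z A B R)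
    (hgen : Subfield.closure {A, B, R} = ⊤) (ha : a % 4 = 1) (hb : b % 4 = 1) (hy : y % 2 = 0)
    (hxy : (x - y) % 4 = 1) : UnramifiedOver K L 2 := by
  refine unramifiedOver_of_closure_eq_top hgen two_ne_zero fun P hP h2 σ hσ ↦ ?_
  rw [Nat.cast_ofNat] at h2
  have hσA : σ A = A := map_eq_of_sq_eq_intCast h2 hσ h.sq_left ha
  rintro _ (rfl | rfl | rfl)
  exacts [hσA, map_eq_of_sq_eq_intCast h2 hσ h.sq_right hb,
    h.map_root_eq_of_even_snd h2 hσ hσA ha hy hxy]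

theorem unramifiedOver_of_even_thd (h : IsRedeiTriple a b (2 * x) (2 * y) (2 * z) A B R)
    (hgen : Subfield.closure {A, B, R} = ⊤) (ha : a % 4 = 1) (hb : b % 4 = 1) (hz : z % 2 = 0)
    (hxz : (x - z) % 4 = 1) : UnramifiedOver K L 2 := by
  refine unramifiedOver_of_closure_eq_top hgen two_ne_zero fun P hP h2 σ hσ ↦ ?_
  rw [Nat.cast_ofNat] at h2
  have hσA : σ A = A := map_eq_of_sq_eq_intCast h2 hσ h.sq_left ha
  have hσB : σ B = B := map_eq_of_sq_eq_intCast h2 hσ h.sq_right hb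
  rintro _ (rfl | rfl | rfl)
  exacts [hσA, hσB, h.map_root_eq_of_even_thd h2 hσ hσA hσB hb hz hxz]

theorem unramifiedOver_of_dvd_left {r : ℤ} (hr : r = 1 ∨ r = p)
    (h : IsRedeiTriple a b (r * x) (r * y) (r * z) A B R)
    (hgen : Subfield.closure {A, B, R} = ⊤) {s : K} (hs : algebraMap K L s = A * B)
    (hp : p.Prime) (hp2 : p ≠ 2) (ha : (p : ℤ) ∣ a) (ha2 : ¬ (p : ℤ) * p ∣ a)
    (hb : ¬ (p : ℤ) ∣ b) (hx : ¬ (p : ℤ) ∣ x) : UnramifiedOver K L p := by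
  refine unramifiedOver_of_closure_eq_top hgen hp.ne_zero fun P hP hpP σ hσ ↦ ?_
  have h2 : (2 : 𝓞 L) ∉ P := two_notMem_of_natCast_mem hp hp2 hpP
  have hσB : σ B = B := map_eq_of_sq_eq_intCast_of_not_dvd hp hp2 hpP hσ hb h.sq_right
  have hb0 : b ≠ 0 := fun h0 ↦ hb (h0 ▸ dvd_zero _)
  have hσA : σ A = A := map_left_eq_of_map_right_eq hs (h.right_ne_zero hb0) hσB
  have hσR : σ R = R := by
    rcases hr with rfl | rfl
    · exact h.map_root_eq_of_not_dvd_fst hp hpP h2 hσ hσA ha (by simpa using hx)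
    · exact h.map_root_eq_of_sq_not_dvd_fst hp hpP h2 hσ hσA ha ha2 hx
  rintro _ (rfl | rfl | rfl)
  exacts [hσA, hσB, hσR]

theorem unramifiedOver_of_split (h : IsRedeiTriple a b x y z A B R)
    (hgen : Subfield.closure {A, B, R} = ⊤) {s : K} (hs : algebraMap K L s = A * B)
    (ha : a ≠ 0) (hb : b % 4 = 1) (hy : y ≠ 0) {w c e m : ℤ} {k : ℕ} (hw : w % 2 = 1)
    (hbw : b - w ^ 2 = 4 ^ (k + 1) * c) (he : e = 1 ∨ e = a)
    (hxw : 2 * e * (x + z * w) = 4 ^ k * (4 * m + 1)) : UnramifiedOver K L 2 := by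
  refine unramifiedOver_of_closure_eq_top hgen two_ne_zero fun P hP h2 σ hσ ↦ ?_
  rw [Nat.cast_ofNat] at h2
  have hσB : σ B = B := map_eq_of_sq_eq_intCast h2 hσ h.sq_right hb
  have hσA : σ A = A := map_left_eq_of_map_right_eq hs (h.right_ne_zero (by omega)) hσB
  obtain ⟨E, hE, he0, hσE⟩ : ∃ E : L, E ^ 2 = e ∧ e ≠ 0 ∧ σ E = E := by
    rcases he with rfl | rfl
    exacts [⟨1, by simp, one_ne_zero, map_one σ⟩, ⟨A, h.sq_left, ha, hσA⟩]
  rintro _ (rfl | rfl | rfl)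
  exacts [hσA, hσB, h.map_root_eq_of_split h2 hσ hσA hσB ha hy hw hbw hE he0 hσE hxw]

end IsRedeiTriple

end UnramifiedTriples

section Composita

theorem isGalois_rat_sup {F F' : IntermediateField ℚ ℂ} [hF : IsGalois ℚ F]
    [hF' : IsGalois ℚ F'] : IsGalois ℚ ↥(F ⊔ F') :=
  @isGalois_sup ℚ ℂ _ _ _ F F' hF hF'

variable {E F F' : IntermediateField ℚ ℂ} [NumberField F] [NumberField F']

theorem numberField_sup : NumberField ↥(F ⊔ F') where
  to_finiteDimensional := IntermediateField.finiteDimensional_sup F F'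

theorem UnramifiedOver.sup_rat [hF : IsGalois ℚ F] [hF' : IsGalois ℚ F'] {p : ℕ} (hp : p ≠ 0)
    (h : UnramifiedOver ℚ F p) (h' : UnramifiedOver ℚ F' p) : UnramifiedOver ℚ ↥(F ⊔ F') p :=
  have := numberField_sup (F := F) (F' := F')
  @UnramifiedOver.sup ℚ _ _ p ℂ _ _ F F' _ _ _ hF hF' hp h h'

theorem UnramifiedOver.sup_extendScalars [NumberField E] [IsGalois ℚ F] [IsGalois ℚ F'] {p : ℕ}
    (hp : p ≠ 0) (h : E ≤ F) (h' : E ≤ F')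
    (hF : UnramifiedOver E (IntermediateField.extendScalars h) p)
    (hF' : UnramifiedOver E (IntermediateField.extendScalars h') p) :
    UnramifiedOver E (IntermediateField.extendScalars (le_sup_of_le_left h : E ≤ F ⊔ F')) p := by
  have := numberField_extendScalars h
  have := numberField_extendScalars h'
  have := isGalois_extendScalars h
  have := isGalois_extendScalars h'
  have : NumberField ↥(IntermediateField.extendScalars h ⊔ IntermediateField.extendScalars h') := by
    rw [IntermediateField.extendScalars_sup]
    exact numberField_sup
  rw [← IntermediateField.extendScalars_sup h h']
  exact hF.sup hp hF'

theorem UnramifiedOver.isFourPowMulOneMod_or_mul_of_mem [IsGalois ℚ F] {a b r : ℤ} {α β s : ℂ}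
    (h : sqrtField (a * b) ≤ F)
    (hF : UnramifiedOver (sqrtField (a * b)) (IntermediateField.extendScalars h) 2) (hαF : α ∈ F)
    (hβF : β ∈ F) (hsF : s ∈ F) (hα : α ^ 2 = a) (hβ : β ^ 2 = b) (hs : s ^ 2 = r) (ha : a ≠ 0)
    (hb : b % 4 = 1) (hr : r ≠ 0) : IsFourPowMulOneMod r ∨ IsFourPowMulOneMod (r * a) := by
  obtain ⟨S, hS, hSgen⟩ := exists_sqrt_closure_eq_top (c := a * b) (s := α * β)
    (by rw [mul_pow, hα, hβ, Int.cast_mul])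
  have := numberField_extendScalars h
  have := isGalois_rat_extendScalars h
  have := isGalois_extendScalars h
  let ofMem (w : ℂ) (hw : w ∈ F) : IntermediateField.extendScalars h := ⟨w, hw⟩
  exact hF.isFourPowMulOneMod_or_mul hSgen (A := ofMem α hαF) (B := ofMem β hβF) (S := ofMem s hsF)
    (Subtype.ext hS) (Subtype.ext hα) (Subtype.ext hβ) ha hb (Subtype.ext hs) hr

end Composita

section Twists

section Rational

variable {a b : ℤ} {α : ℂ} {x y x' y' q t t' : ℚ}

theorem extField_sq_mul (hq : q ≠ 0) :
    extField a b α (q ^ 2 * x) (q ^ 2 * y) = extField a b α x y := by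
  have hle {q x y : ℚ} (hq : q ≠ 0) :
      extField a b α (q ^ 2 * x) (q ^ 2 * y) ≤ extField a b α x y := by
    refine sup_le le_sup_left (IntermediateField.adjoin_le_iff.mpr fun w hw ↦ ?_)
    have hq' : (q : ℂ) ≠ 0 := by exact_mod_cast hq
    have hwq : w / q ∈ extField a b α x y := by
      refine SetLike.le_def.mp le_sup_right (IntermediateField.subset_adjoin ℚ _ ?_)
      simp only [Set.mem_ofPred_eq, Rat.cast_mul, Rat.cast_pow] at hw ⊢
      rw [div_pow, hw]
      field_simp
    rw [← div_mul_cancel₀ w hq']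
    exact mul_mem hwq (SubfieldClass.ratCast_mem _ q)
  refine le_antisymm (hle hq) ?_
  have h := hle (x := q ^ 2 * x) (y := q ^ 2 * y) (inv_ne_zero hq)
  simpa only [inv_pow, inv_mul_cancel_left₀ (pow_ne_zero 2 hq)] using h

theorem twist_congr (hq : q ≠ 0) (hx : t * x = q ^ 2 * (t' * x')) (hy : t * y = q ^ 2 * (t' * y')) :
    twist a b α x y t = twist a b α x' y' t' := by
  rw [twist, hx, hy, extField_sq_mul hq, twist]

theorem twistOverK_congr (h : twist a b α x y t = twist a b α x' y' t') :
    twistOverK a b α x y t = twistOverK a b α x' y' t' :=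
  IntermediateField.restrictScalars_injective ℚ h

end Rational

section Integral

variable {a b x y z t t' : ℤ} {α β γ : ℂ}

theorem twist_intCast : twist a b α x y t = extField a b α (t * x : ℤ) (t * y : ℤ) := by
  simp only [twist, Int.cast_mul]

theorem twistOverK_intCast :
    twistOverK a b α x y t = extFieldOverK a b α (t * x : ℤ) (t * y : ℤ) := by
  simp only [twistOverK, Int.cast_mul]

namespace IsRedeiTriple

theorem mul {L : Type*} [Field L] {A B R τ : L} (h : IsRedeiTriple a b x y z A B R)
    (hτ : τ ^ 2 = t) : IsRedeiTriple a b (t * x) (t * y) (t * z) A B (τ * R) where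
  sq_left := h.sq_left
  sq_right := h.sq_right
  sq_root := by
    rw [mul_pow, hτ, h.sq_root, Int.cast_mul, Int.cast_mul]
    ring
  norm_eq := by linear_combination t ^ 2 * h.norm_eq

theorem exists_mul (h : IsRedeiTriple a b x y z α β γ) (hγ : γ ≠ 0) (ht : t ≠ 0) :
    ∃ τ : ℂ, τ ^ 2 = t ∧ τ * γ ≠ 0 ∧ IsRedeiTriple a b (t * x) (t * y) (t * z) α β (τ * γ) := by
  obtain ⟨τ, hτ⟩ := IsAlgClosed.exists_pow_nat_eq (t : ℂ) two_pos
  refine ⟨τ, hτ, mul_ne_zero ?_ hγ, h.mul hτ⟩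
  exact ne_zero_pow two_ne_zero (hτ.trans_ne (Int.cast_ne_zero.mpr ht))

theorem numberField_twist (h : IsRedeiTriple a b x y z α β γ) (hγ : γ ≠ 0) (ht : t ≠ 0) :
    NumberField (twist a b α x y t) := by
  obtain ⟨τ, -, hτγ, h'⟩ := h.exists_mul hγ ht
  exact twist_intCast ▸ h'.numberField_extField hτγ

theorem isGalois_twist (h : IsRedeiTriple a b x y z α β γ) (hγ : γ ≠ 0) (ht : t ≠ 0) :
    IsGalois ℚ (twist a b α x y t) := by
  obtain ⟨τ, -, hτγ, h'⟩ := h.exists_mul hγ ht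
  exact twist_intCast ▸ h'.isGalois_extField hτγ

theorem exists_mem_twist_sup_sq_eq (h : IsRedeiTriple a b x y z α β γ) (hγ : γ ≠ 0)
    (ht : t ≠ 0) (ht' : t' ≠ 0) :
    ∃ s ∈ twist a b α x y t ⊔ twist a b α x y t', s ^ 2 = ((t * t' : ℤ) : ℂ) := by
  obtain ⟨τ, hτ, -, hτγ⟩ := h.exists_mul hγ ht
  obtain ⟨τ', hτ', -, hτγ'⟩ := h.exists_mul hγ ht'
  set M := twist a b α x y t ⊔ twist a b α x y t'
  have hle : twist a b α x y t ≤ M := le_sup_left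
  have hle' : twist a b α x y t' ≤ M := le_sup_right
  rw [twist_intCast] at hle hle'
  have hγM : γ ^ 2 ∈ M := by
    rw [h.sq_root]
    exact add_mem (intCast_mem M x) (mul_mem (intCast_mem M y) (hle hτγ.left_mem_extField))
  refine ⟨τ * τ', ?_, by simp [mul_pow, hτ, hτ']⟩
  rw [← mul_div_cancel_right₀ (τ * τ') (pow_ne_zero 2 hγ), sq γ, mul_mul_mul_comm, ← sq γ]
  exact div_mem (mul_mem (hle hτγ.root_mem_extField) (hle' hτγ'.root_mem_extField)) hγM

theorem exists_unramifiedOver_sq_eq (h : IsRedeiTriple a b x y z α β γ) (hγ : γ ≠ 0)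
    (ht : t ≠ 0) (ht' : t' ≠ 0) {p : ℕ} (hp : p ≠ 0)
    (hU : UnramifiedOver ℚ (twist a b α x y t) p) (hU' : UnramifiedOver ℚ (twist a b α x y t') p) :
    ∃ (M : IntermediateField ℚ ℂ) (_ : NumberField M) (_ : IsGalois ℚ M),
      UnramifiedOver ℚ M p ∧ ∃ s : M, s ^ 2 = (t * t' : ℤ) := by
  obtain ⟨s, hs, hst⟩ := h.exists_mem_twist_sup_sq_eq hγ ht ht'
  have := h.numberField_twist hγ ht
  have := h.numberField_twist hγ ht'
  have hG := h.isGalois_twist hγ ht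
  have hG' := h.isGalois_twist hγ ht'
  have := numberField_sup (F := twist a b α x y t) (F' := twist a b α x y t')
  exact ⟨_, this, isGalois_rat_sup, hU.sup_rat hp hU', ⟨s, hs⟩, Subtype.ext hst⟩

theorem mul_ne_mul_of_unramifiedOver (h : IsRedeiTriple a b x y z α β γ) (hγ : γ ≠ 0)
    (ht : t ≠ 0) (ht' : t' ≠ 0) {p : ℕ} (hp : p.Prime)
    (hU : UnramifiedOver ℚ (twist a b α x y t) p) (hU' : UnramifiedOver ℚ (twist a b α x y t') p)
    {m : ℤ} (hm : ¬ (p : ℤ) ∣ m) : t * t' ≠ p * m := by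
  intro htm
  obtain ⟨M, _, _, hM, s, hs⟩ := h.exists_unramifiedOver_sq_eq hγ ht ht' hp.ne_zero hU hU'
  exact hM.sq_ne_mul hp hm s (by rw [hs, htm, Int.cast_mul, Int.cast_natCast])

theorem isFourPowMulOneMod_mul (h : IsRedeiTriple a b x y z α β γ) (hγ : γ ≠ 0)
    (ht : t ≠ 0) (ht' : t' ≠ 0) (hU : UnramifiedOver ℚ (twist a b α x y t) 2)
    (hU' : UnramifiedOver ℚ (twist a b α x y t') 2) : IsFourPowMulOneMod (t * t') := by
  obtain ⟨M, _, _, hM, s, hs⟩ := h.exists_unramifiedOver_sq_eq hγ ht ht' two_ne_zero hU hU'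
  exact hM.isFourPowMulOneMod (mul_ne_zero ht ht') hs

theorem isFourPowMulOneMod_mul_overK (h : IsRedeiTriple a b x y z α β γ) (hγ : γ ≠ 0)
    (ha : a ≠ 0) (hb : b % 4 = 1) (ht : t ≠ 0) (ht' : t' ≠ 0)
    (hU : UnramifiedOver (sqrtField (a * b)) (twistOverK a b α x y t) 2)
    (hU' : UnramifiedOver (sqrtField (a * b)) (twistOverK a b α x y t') 2) :
    IsFourPowMulOneMod (t * t') ∨ IsFourPowMulOneMod (t * t' * a) := by
  obtain ⟨S, hS, hSt⟩ := h.exists_mem_twist_sup_sq_eq hγ ht ht'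
  obtain ⟨τ, -, -, h'⟩ := h.exists_mul hγ ht
  have := h.numberField_twist hγ ht
  have := h.numberField_twist hγ ht'
  have := h.isGalois_twist hγ ht
  have := h.isGalois_twist hγ ht'
  have := numberField_sup (F := twist a b α x y t) (F' := twist a b α x y t')
  have := isGalois_rat_sup (F := twist a b α x y t) (F' := twist a b α x y t')
  have hα : α ∈ twist a b α x y t := twist_intCast ▸ h'.left_mem_extField
  have hβ : β ∈ twist a b α x y t := twist_intCast ▸ h'.right_mem_extField
  have hle := sqrtField_mul_le_extField a b α
  exact (UnramifiedOver.sup_extendScalars (F := twist a b α x y t) (F' := twist a b α x y t')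
    two_ne_zero (hle _ _) (hle _ _) hU hU').isFourPowMulOneMod_or_mul_of_mem _
    (SetLike.le_def.mp le_sup_left hα) (SetLike.le_def.mp le_sup_left hβ) hS h.sq_left h.sq_right
    hSt ha hb (mul_ne_zero ht ht')

end IsRedeiTriple

end Integral

end Twists

section PrimitiveSolutions

theorem exists_eq_sq_mul_intCast {ι : Type*} [Finite ι] (f : ι → ℚ) :
    ∃ q : ℚ, q ≠ 0 ∧ ∃ g : ι → ℤ, ∀ i, f i = q ^ 2 * g i := by
  obtain ⟨d, hd⟩ := IsLocalization.exist_integer_multiples_of_finite (nonZeroDivisors ℤ) f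
  choose g hg using hd
  have hd0 : ((d : ℤ) : ℚ) ≠ 0 := Int.cast_ne_zero.mpr (nonZeroDivisors.ne_zero d.2)
  refine ⟨(d : ℤ)⁻¹, inv_ne_zero hd0, fun i ↦ d * g i, fun i ↦ ?_⟩
  have hgi : (g i : ℚ) = (d : ℤ) * f i := by simpa using hg i
  rw [Int.cast_mul, hgi]
  field_simp

theorem exists_eq_pow_mul_and_exists_not_dvd {ι : Type*} {g : ι → ℤ} (hg : g ≠ 0) {p : ℕ}
    (hp : p.Prime) :
    ∃ (k : ℕ) (g' : ι → ℤ), (∀ i, g i = p ^ k * g' i) ∧ ∃ i, ¬ (p : ℤ) ∣ g' i := by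
  obtain ⟨i₀, hi₀⟩ := Function.ne_iff.mp hg
  have hbound : ∃ n : ℕ, ∃ i, ¬ (p : ℤ) ^ (n + 1) ∣ g i :=
    (Int.finiteMultiplicity_iff.mpr ⟨by simpa using hp.ne_one, hi₀⟩).imp fun _ h ↦ ⟨i₀, h⟩
  classical
  have hdvd (i : ι) : (p : ℤ) ^ Nat.find hbound ∣ g i := by
    rcases hk : Nat.find hbound with - | k
    · simp
    · by_contra hi
      exact Nat.find_min hbound (hk ▸ k.lt_succ_self) ⟨i, hi⟩
  choose g' hg' using hdvd
  obtain ⟨i, hi⟩ := Nat.find_spec hbound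
  refine ⟨_, g', hg', i, fun h ↦ hi ?_⟩
  rw [hg' i, pow_succ]
  exact mul_dvd_mul_left _ h

theorem exists_eq_sq_mul_mul_and_exists_not_dvd {ι : Type*} [Finite ι] {f : ι → ℚ} (hf : f ≠ 0)
    {p : ℕ} (hp : p.Prime) :
    ∃ q : ℚ, q ≠ 0 ∧ ∃ r : ℤ, (r = 1 ∨ r = p) ∧ ∃ g : ι → ℤ,
      (∀ i, f i = q ^ 2 * (r * g i)) ∧ ∃ i, ¬ (p : ℤ) ∣ g i := by
  obtain ⟨q, hq, g, hfg⟩ := exists_eq_sq_mul_intCast f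
  have hg : g ≠ 0 := by
    rintro rfl
    exact hf (funext fun i ↦ by simp [hfg])
  obtain ⟨k, g', hg', hndvd⟩ := exists_eq_pow_mul_and_exists_not_dvd hg hp
  have hp0 : (p : ℚ) ≠ 0 := Nat.cast_ne_zero.mpr hp.ne_zero
  refine ⟨q * p ^ (k / 2), mul_ne_zero hq (pow_ne_zero _ hp0), p ^ (k % 2), ?_, g', fun i ↦ ?_,
    hndvd⟩
  · rcases Nat.mod_two_eq_zero_or_one k with h | h <;> simp [h]
  · rw [hfg, hg']
    nth_rw 1 [← Nat.mod_add_div k 2]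
    push_cast
    ring

theorem eq_zero_of_sq_eq_mul_sq {c u v : ℤ} (hc : Squarefree c) (hc1 : c ≠ 1)
    (h : u ^ 2 = c * v ^ 2) : v = 0 := by
  by_contra hv
  obtain ⟨w, rfl⟩ : v ∣ u := (Int.pow_dvd_pow_iff two_ne_zero).mp ⟨c, by rw [h, mul_comm]⟩
  have hwc : w ^ 2 = c := mul_left_cancel₀ (pow_ne_zero 2 hv) (by linear_combination h)
  have hw : IsUnit w := hc w (by rw [← hwc, sq])
  exact hc1 (by rw [← hwc, Int.isUnit_sq hw])

theorem exists_primitive_multiple {x y z : ℚ} (hxyz : (x, y, z) ≠ (0, 0, 0)) {p : ℕ}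
    (hp : p.Prime) :
    ∃ q : ℚ, q ≠ 0 ∧ ∃ r X Y Z : ℤ, (r = 1 ∨ r = p) ∧ x = q ^ 2 * (r * X) ∧
      y = q ^ 2 * (r * Y) ∧ z = q ^ 2 * (r * Z) ∧
      ¬ ((p : ℤ) ∣ X ∧ (p : ℤ) ∣ Y ∧ (p : ℤ) ∣ Z) := by
  have hf : ![x, y, z] ≠ 0 := by
    contrapose hxyz
    simpa using hxyz
  obtain ⟨q, hq, r, hr, g, hg, i, hi⟩ := exists_eq_sq_mul_mul_and_exists_not_dvd hf hp
  refine ⟨q, hq, r, g 0, g 1, g 2, hr, hg 0, hg 1, hg 2, fun ⟨h0, h1, h2⟩ ↦ hi ?_⟩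
  fin_cases i
  exacts [h0, h1, h2]

theorem snd_ne_zero_of_norm_eq {b : ℤ} (hb : Squarefree b) (hb1 : b ≠ 1) {a x y z : ℤ}
    (heq : x ^ 2 - a * y ^ 2 = b * z ^ 2) (hxyz : (x, y, z) ≠ 0) : y ≠ 0 := by
  rintro rfl
  rw [zero_pow two_ne_zero, mul_zero, sub_zero] at heq
  obtain rfl := eq_zero_of_sq_eq_mul_sq hb hb1 heq
  exact hxyz (by simpa using heq)

theorem IsRedeiTriple.root_ne_zero {a b x y z : ℤ} {α β γ : ℂ} (h : IsRedeiTriple a b x y z α β γ)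
    (ha : Squarefree a) (ha1 : a ≠ 1) (hy : y ≠ 0) : γ ≠ 0 := by
  rintro rfl
  have hxy : (x : ℂ) ^ 2 = a * y ^ 2 := by
    linear_combination (y * α - x) * h.sq_root + y ^ 2 * h.sq_left
  exact hy (eq_zero_of_sq_eq_mul_sq ha ha1 (by exact_mod_cast hxy))

theorem exists_primitive_isRedeiTriple {a b : ℤ} (ha : Squarefree a) (ha1 : a ≠ 1)
    (hb : Squarefree b) (hb1 : b ≠ 1) {x y z : ℚ} (hxyz : (x, y, z) ≠ (0, 0, 0))
    (heq : x ^ 2 - a * y ^ 2 = b * z ^ 2) {α : ℂ} (hα : α ^ 2 = a) {p : ℕ} (hp : p.Prime) :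
    ∃ (r X Y Z : ℤ) (β γ : ℂ), (r = 1 ∨ r = p) ∧ IsRedeiTriple a b X Y Z α β γ ∧ γ ≠ 0 ∧ Y ≠ 0 ∧
      ¬ ((p : ℤ) ∣ X ∧ (p : ℤ) ∣ Y ∧ (p : ℤ) ∣ Z) ∧
      ∀ t, twist a b α x y t = twist a b α X Y (t * r) := by
  obtain ⟨q, hq, r, X, Y, Z, hr, rfl, rfl, rfl, hprim⟩ := exists_primitive_multiple hxyz hp
  have hr0 : (r : ℚ) ≠ 0 := by
    rcases hr with rfl | rfl
    exacts [by simp, by exact_mod_cast hp.ne_zero]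
  have heqZ : X ^ 2 - a * Y ^ 2 = b * Z ^ 2 := by
    have hqr : (q ^ 2 * r) ^ 2 ≠ 0 := pow_ne_zero 2 (mul_ne_zero (pow_ne_zero 2 hq) hr0)
    exact_mod_cast mul_left_cancel₀ hqr (by linear_combination heq :
      (q ^ 2 * r) ^ 2 * ((X : ℚ) ^ 2 - a * Y ^ 2) = (q ^ 2 * r) ^ 2 * (b * Z ^ 2))
  have hY : Y ≠ 0 := snd_ne_zero_of_norm_eq hb hb1 heqZ fun h ↦ hprim (by simp_all)
  obtain ⟨β, γ, h⟩ := exists_isRedeiTriple hα heqZ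
  exact ⟨r, X, Y, Z, β, γ, hr, h, h.root_ne_zero ha ha1 hY, hY, hprim,
    fun t ↦ twist_congr hq (by ring) (by ring)⟩

end PrimitiveSolutions

section Congruences

variable {a b x y z : ℤ}

theorem not_four_dvd_of_squarefree (ha : Squarefree a) : ¬ 4 ∣ a :=
  fun h ↦ absurd (ha 2 h) (by decide)

theorem not_isFourPowMulOneMod_of_squarefree (ha : Squarefree a) (ha4 : a % 4 ≠ 1) :
    ¬ IsFourPowMulOneMod a := by
  simpa using (isFourPowMulOneMod_four_pow_mul_iff 0 (not_four_dvd_of_squarefree ha)).not.mpr ha4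

theorem odd_fst_of_norm_eq (ha : a % 4 = 1) (hb : b % 4 = 1)
    (heq : x ^ 2 - a * y ^ 2 = b * z ^ 2) (hprim : ¬ (2 ∣ x ∧ 2 ∣ y ∧ 2 ∣ z)) :
    x % 2 = 1 ∧ (y % 2 = 0 ∨ z % 2 = 0) := by
  have hmod : ∀ x y z : ZMod 4, x ^ 2 - 1 * y ^ 2 = 1 * z ^ 2 →
      (2 * x = 0 ∧ 2 * y = 0 ∧ 2 * z = 0) ∨ 2 * x ≠ 0 ∧ (2 * y = 0 ∨ 2 * z = 0) := by decide
  have hcast {c : ℤ} (hc : c % 4 = 1) : (c : ZMod 4) = 1 := by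
    exact_mod_cast (ZMod.intCast_eq_intCast_iff_dvd_sub c 1 4).mpr (by omega)
  have heven (c : ℤ) : 2 * (c : ZMod 4) = 0 ↔ c % 2 = 0 := by
    rw [← Int.cast_ofNat, ← Int.cast_mul, ZMod.intCast_zmod_eq_zero_iff_dvd]
    omega
  have heq4 : (x : ZMod 4) ^ 2 - a * y ^ 2 = b * z ^ 2 := by exact_mod_cast congrArg _ heq
  rw [hcast ha, hcast hb] at heq4
  have h := hmod x y z heq4
  simp only [heven, ne_eq] at h
  omega

theorem mod_four_eq_three_of_norm_eq (ha : Squarefree a) (ha4 : a % 4 ≠ 1) (hb : b % 8 = 5)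
    (heq : x ^ 2 - a * y ^ 2 = b * z ^ 2) (hprim : ¬ (2 ∣ x ∧ 2 ∣ y ∧ 2 ∣ z)) : a % 4 = 3 := by
  have ha0 := not_four_dvd_of_squarefree ha
  by_contra ha3
  have hmod : ∀ x y z c : ZMod 8, c = 2 ∨ c = 6 → x ^ 2 - c * y ^ 2 = 5 * z ^ 2 →
      4 * x = 0 ∧ 4 * y = 0 ∧ 4 * z = 0 := by decide
  have heven (c : ℤ) (hc : 4 * (c : ZMod 8) = 0) : 2 ∣ c := by
    rw [← Int.cast_ofNat, ← Int.cast_mul, ZMod.intCast_zmod_eq_zero_iff_dvd] at hc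
    omega
  have hcast {c d : ℤ} (h : c % 8 = d % 8) : (c : ZMod 8) = d :=
    (ZMod.intCast_eq_intCast_iff c d 8).mpr h
  have ha8 : (a : ZMod 8) = 2 ∨ (a : ZMod 8) = 6 := by
    have h : a % 8 = 2 ∨ a % 8 = 6 := by omega
    exact h.imp (fun h ↦ hcast (d := 2) h) (fun h ↦ hcast (d := 6) h)
  have heq8 : (x : ZMod 8) ^ 2 - a * y ^ 2 = b * z ^ 2 := by exact_mod_cast congrArg _ heq
  rw [hcast (d := 5) hb] at heq8
  obtain ⟨hx, hy, hz⟩ := hmod x y z a ha8 heq8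
  exact hprim ⟨heven x hx, heven y hy, heven z hz⟩

theorem exists_sign_mul_mod_four_eq_one {n : ℤ} (hn : n % 2 = 1) :
    ∃ δ : ℤ, (δ = 1 ∨ δ = -1) ∧ (δ * n) % 4 = 1 := by
  have h : n % 4 = 1 ∨ n % 4 = 3 := by omega
  rcases h with h | h
  exacts [⟨1, by omega⟩, ⟨-1, by omega⟩]

theorem exists_sq_sub_eq_two_pow (hb : b % 8 = 1) (n : ℕ) :
    ∃ w c : ℤ, w % 2 = 1 ∧ b - w ^ 2 = 2 ^ (n + 3) * c := by
  induction n with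
  | zero => exact ⟨1, b / 8, by norm_num, by norm_num; omega⟩
  | succ n ih =>
    obtain ⟨w, c, hw, h⟩ := ih
    obtain ⟨v, rfl⟩ : ∃ v, w = 2 * v + 1 := ⟨w / 2, by omega⟩
    rcases Int.even_or_odd' c with ⟨d, rfl | rfl⟩
    · exact ⟨2 * v + 1, d, hw, by rw [h]; ring⟩
    · refine ⟨2 * v + 1 + 2 ^ (n + 2), d - v - 2 ^ n, by rw [pow_add]; omega, ?_⟩
      linear_combination h

theorem exists_sq_sub_eq_four_pow (hb : b % 8 = 1) (n : ℕ) :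
    ∃ w c : ℤ, w % 2 = 1 ∧ b - w ^ 2 = 4 ^ n * c := by
  obtain ⟨w, c, hw, h⟩ := exists_sq_sub_eq_two_pow hb (2 * n)
  exact ⟨w, 8 * c, hw, by rw [h, pow_add, pow_mul]; ring⟩

theorem exists_two_adic_sqrt_of_norm_eq (ha : a ≠ 0) (hb : b % 8 = 1) (hy : y ≠ 0)
    (heq : x ^ 2 - a * y ^ 2 = b * z ^ 2) :
    ∃ (w c : ℤ) (n : ℕ), w % 2 = 1 ∧ b - w ^ 2 = 4 ^ n * c ∧
      ∀ k : ℕ, 4 ^ k ∣ 8 * a * (x + z * w) → k < n := by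
  have hne : 8 * a ^ 2 * y ^ 2 ≠ 0 := by positivity
  obtain ⟨n, hn⟩ := (Int.finiteMultiplicity_iff.mpr ⟨by decide, hne⟩ :
    FiniteMultiplicity 4 (8 * a ^ 2 * y ^ 2))
  obtain ⟨w, c, hw, hwb⟩ := exists_sq_sub_eq_four_pow hb (n + 1)
  refine ⟨w, c, n + 1, hw, hwb, fun k hk ↦ ?_⟩
  by_contra! hnk
  have hdvd : 4 ^ (n + 1) ∣ 8 * a * (x + z * w) * (x - z * w) :=
    ((pow_dvd_pow 4 hnk).trans hk).mul_right _
  rw [show 8 * a * (x + z * w) * (x - z * w) =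
    8 * a ^ 2 * y ^ 2 + 4 ^ (n + 1) * (8 * a * c * z ^ 2) by
      linear_combination 8 * a * heq + 8 * a * z ^ 2 * hwb] at hdvd
  exact hn ((dvd_add_left (dvd_mul_right _ _)).mp hdvd)

end Congruences

section IntegralTwists

variable {a b x y z t : ℤ} {α β γ : ℂ}

namespace IsRedeiTriple

theorem exists_lift_twist (h : IsRedeiTriple a b x y z α β γ) (hγ : γ ≠ 0) (ht : t ≠ 0) :
    ∃ A B R : twist a b α x y t, IsRedeiTriple a b (t * x) (t * y) (t * z) A B R ∧
      Subfield.closure {A, B, R} = ⊤ := by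
  obtain ⟨τ, -, -, h'⟩ := h.exists_mul hγ ht
  obtain ⟨A, B, R, -, -, -, hABR, hgen⟩ := h'.exists_lift
  exact twist_intCast ▸ ⟨A, B, R, hABR, hgen⟩

theorem exists_lift_twistOverK (h : IsRedeiTriple a b x y z α β γ) (hγ : γ ≠ 0) (ht : t ≠ 0) :
    ∃ (A B R : twistOverK a b α x y t) (s : sqrtField (a * b)),
      IsRedeiTriple a b (t * x) (t * y) (t * z) A B R ∧ Subfield.closure {A, B, R} = ⊤ ∧ R ≠ 0 ∧
        algebraMap _ _ s = A * B ∧ Subfield.closure {s} = ⊤ := by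
  obtain ⟨τ, -, hτγ, h'⟩ := h.exists_mul hγ ht
  obtain ⟨A, B, R, s, hABR, hgen, hR, hs, hsgen⟩ := h'.exists_lift_overK
  have hR0 : R ≠ 0 := by
    rintro rfl
    exact hτγ hR.symm
  exact twistOverK_intCast ▸ ⟨A, B, R, s, hABR, hgen, hR0, hs, hsgen⟩

theorem numberField_twistOverK (h : IsRedeiTriple a b x y z α β γ) (hγ : γ ≠ 0) (ht : t ≠ 0) :
    NumberField (twistOverK a b α x y t) :=
  have : NumberField (extField a b α (t * x) (t * y)) := h.numberField_twist hγ ht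
  numberField_extendScalars (sqrtField_mul_le_extField a b α _ _)

theorem isGalois_rat_twistOverK (h : IsRedeiTriple a b x y z α β γ) (hγ : γ ≠ 0) (ht : t ≠ 0) :
    IsGalois ℚ (twistOverK a b α x y t) :=
  have : IsGalois ℚ (extField a b α (t * x) (t * y)) := h.isGalois_twist hγ ht
  isGalois_rat_extendScalars (sqrtField_mul_le_extField a b α _ _)

theorem isGalois_twistOverK (h : IsRedeiTriple a b x y z α β γ) (hγ : γ ≠ 0) (ht : t ≠ 0) :
    IsGalois (sqrtField (a * b)) (twistOverK a b α x y t) :=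
  have : IsGalois ℚ (extField a b α (t * x) (t * y)) := h.isGalois_twist hγ ht
  isGalois_extendScalars (sqrtField_mul_le_extField a b α _ _)

theorem unramifiedOver_twist_one {p : ℕ} (h : IsRedeiTriple a b x y z α β γ) (hγ : γ ≠ 0)
    (hp : p.Prime) (hp2 : p ≠ 2) (ha : ¬ (p : ℤ) ∣ a) (hb : ¬ (p : ℤ) ∣ b)
    (hprim : ¬ ((p : ℤ) ∣ x ∧ (p : ℤ) ∣ y ∧ (p : ℤ) ∣ z)) :
    UnramifiedOver ℚ (twist a b α x y (1 : ℤ)) p := by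
  obtain ⟨A, B, R, hABR, hgen⟩ := h.exists_lift_twist hγ one_ne_zero
  have := h.numberField_twist hγ one_ne_zero
  have := h.isGalois_twist hγ one_ne_zero
  simp only [one_mul] at hABR
  exact hABR.unramifiedOver_of_not_dvd hgen hp hp2 ha hb hprim

theorem exists_unramifiedOver_twist_two (h : IsRedeiTriple a b x y z α β γ) (hγ : γ ≠ 0)
    (ha : a % 4 = 1) (hb : b % 4 = 1) (hprim : ¬ (2 ∣ x ∧ 2 ∣ y ∧ 2 ∣ z)) :
    ∃ δ : ℤ, δ ∈ twistReps ∧ UnramifiedOver ℚ (twist a b α x y δ) 2 := by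
  obtain ⟨hx, hy | hz⟩ := odd_fst_of_norm_eq ha hb h.norm_eq hprim
  · obtain ⟨δ, hδ, hδxy⟩ := exists_sign_mul_mod_four_eq_one (n := x - y) (by omega)
    have hδ0 : δ ≠ 0 := by omega
    have := h.numberField_twist hγ hδ0
    have := h.isGalois_twist hγ hδ0
    obtain ⟨A, B, R, hABR, hgen⟩ := h.exists_lift_twist hγ hδ0
    refine ⟨δ, by rcases hδ with rfl | rfl <;> simp [twistReps], ?_⟩
    exact hABR.unramifiedOver_of_even_snd hgen ha hb (by rw [Int.mul_emod, hy]; simp)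
      (by rwa [← mul_sub])
  · obtain ⟨δ, hδ, hδxz⟩ := exists_sign_mul_mod_four_eq_one (n := x - z) (by omega)
    have hδ0 : 2 * δ ≠ 0 := by omega
    have := h.numberField_twist hγ hδ0
    have := h.isGalois_twist hγ hδ0
    obtain ⟨A, B, R, hABR, hgen⟩ := h.exists_lift_twist hγ hδ0
    simp only [mul_assoc] at hABR
    refine ⟨2 * δ, by rcases hδ with rfl | rfl <;> simp [twistReps], ?_⟩
    exact hABR.unramifiedOver_of_even_thd hgen ha hb (by rw [Int.mul_emod, hz]; simp)
      (by rwa [← mul_sub])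

theorem unramifiedOver_twistOverK_of_dvd_left {p : ℕ} (h : IsRedeiTriple a b x y z α β γ)
    (hγ : γ ≠ 0) (hr : t = 1 ∨ t = p) (hp : p.Prime) (hp2 : p ≠ 2) (ha : (p : ℤ) ∣ a)
    (ha2 : ¬ (p : ℤ) * p ∣ a) (hb : ¬ (p : ℤ) ∣ b)
    (hprim : ¬ ((p : ℤ) ∣ x ∧ (p : ℤ) ∣ y ∧ (p : ℤ) ∣ z)) :
    UnramifiedOver (sqrtField (a * b)) (twistOverK a b α x y t) p := by
  have ht : t ≠ 0 := by
    rcases hr with rfl | rfl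
    exacts [one_ne_zero, Nat.cast_ne_zero.mpr hp.ne_zero]
  have := h.numberField_twistOverK hγ ht
  have := h.isGalois_twistOverK hγ ht
  obtain ⟨A, B, R, s, hABR, hgen, -, hs, -⟩ := h.exists_lift_twistOverK hγ ht
  exact hABR.unramifiedOver_of_dvd_left hr hgen hs hp hp2 ha ha2 hb
    (not_dvd_fst_of_norm_eq hp h.norm_eq ha ha2 hb hprim)

theorem not_unramifiedOver_twistOverK (h : IsRedeiTriple a b x y z α β γ) (hγ : γ ≠ 0)
    (hy : y ≠ 0) (ht : t ≠ 0) (ha : a % 4 = 3) (hb : b % 8 = 5) :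
    ¬ UnramifiedOver (sqrtField (a * b)) (twistOverK a b α x y t) 2 := by
  have := h.numberField_twistOverK hγ ht
  have := h.isGalois_rat_twistOverK hγ ht
  have := h.isGalois_twistOverK hγ ht
  obtain ⟨A, B, R, s, hABR, -, hR, hs, hsgen⟩ := h.exists_lift_twistOverK hγ ht
  exact hABR.not_unramifiedOver hsgen hs hR (mul_ne_zero ht hy) ha hb

theorem exists_unramifiedOver_of_isFourPowMulOneMod (h : IsRedeiTriple a b x y z α β γ)
    (hγ : γ ≠ 0) (ha : a ≠ 0) (hb : b % 8 = 1) (hy : y ≠ 0) :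
    ∃ n : ℤ, n ≠ 0 ∧ ∀ t : ℤ, t ∣ 4 →
      IsFourPowMulOneMod (t * n) ∨ IsFourPowMulOneMod (t * (n * a)) →
        UnramifiedOver (sqrtField (a * b)) (twistOverK a b α x y t) 2 := by
  obtain ⟨w, c, N, hw, hwb, hN⟩ := exists_two_adic_sqrt_of_norm_eq ha hb hy h.norm_eq
  refine ⟨2 * (x + z * w), fun h0 ↦ (hN N ?_).false, fun t ht hU ↦ ?_⟩
  · rw [show 8 * a * (x + z * w) = 4 * a * (2 * (x + z * w)) by ring, h0, mul_zero]
    exact dvd_zero _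
  have ht0 : t ≠ 0 := by rintro rfl; simp at ht
  have := h.numberField_twistOverK hγ ht0
  have := h.isGalois_twistOverK hγ ht0
  obtain ⟨A, B, R, s, hABR, hgen, -, hs, -⟩ := h.exists_lift_twistOverK hγ ht0
  obtain ⟨e, k, m, he, hea, hkm⟩ : ∃ (e : ℤ) (k : ℕ) (m : ℤ), (e = 1 ∨ e = a) ∧ e ∣ a ∧
      2 * e * (t * x + t * z * w) = 4 ^ k * (4 * m + 1) := by
    rcases hU with ⟨k, m, hkm⟩ | ⟨k, m, hkm⟩
    exacts [⟨1, k, m, .inl rfl, one_dvd a, by rw [← hkm]; ring⟩,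
      ⟨a, k, m, .inr rfl, dvd_rfl, by rw [← hkm]; ring⟩]
  have hkN : k < N := by
    refine hN k (.trans ⟨4 * m + 1, hkm⟩ ?_)
    rw [show 2 * e * (t * x + t * z * w) = t * e * (2 * (x + z * w)) by ring,
      show 8 * a * (x + z * w) = 4 * a * (2 * (x + z * w)) by ring]
    exact mul_dvd_mul_right (mul_dvd_mul ht hea) _
  obtain ⟨d, rfl⟩ := Nat.exists_eq_add_of_lt hkN
  exact hABR.unramifiedOver_of_split hgen hs ha (by omega) (mul_ne_zero ht0 hy) hw
    (c := 4 ^ d * c) (by rw [hwb]; ring) he hkm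

theorem exists_unramifiedOver_iff_isFourPowMulOneMod (h : IsRedeiTriple a b x y z α β γ)
    (hγ : γ ≠ 0) (ha : a ≠ 0) (hb : b % 8 = 1) (hy : y ≠ 0) :
    ∃ n : ℤ, n ≠ 0 ∧ ∀ t : ℤ, t ∣ 4 →
      (UnramifiedOver (sqrtField (a * b)) (twistOverK a b α x y t) 2 ↔
       IsFourPowMulOneMod (t * n) ∨ IsFourPowMulOneMod (t * (n * a))) := by
  obtain ⟨n, hn, hU⟩ := h.exists_unramifiedOver_of_isFourPowMulOneMod hγ ha hb hy
  refine ⟨n, hn, fun t ht ↦ ⟨fun htU ↦ ?_, hU t ht⟩⟩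
  obtain ⟨s, hs, hsn⟩ := IsFourPowMulOneMod.exists_mul hn
  have hs4 : s ∣ 4 := by rcases hs with rfl | rfl | rfl | rfl <;> decide
  have hs0 := ne_zero_of_mem_twistReps hs
  have ht0 : t ≠ 0 := by rintro rfl; simp at ht
  refine (h.isFourPowMulOneMod_mul_overK hγ ha (by omega) ht0 hs0 htU (hU s hs4 (.inl hsn))).imp
    (fun hts ↦ hts.mul_trans hsn ht0 hs0 hn) fun hts ↦ ?_
  rw [← mul_assoc, mul_right_comm]
  rw [mul_right_comm] at hts
  exact hts.mul_trans hsn (mul_ne_zero ht0 ha) hs0 hn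

end IsRedeiTriple

end IntegralTwists

section RationalTwists

variable {a b : ℤ} {x y z : ℚ} {α : ℂ} {p : ℕ}

theorem existsUnique_unramifiedOver_twist_of_odd (ha : Squarefree a) (ha1 : a ≠ 1)
    (hb : Squarefree b) (hb1 : b ≠ 1) (hxyz : (x, y, z) ≠ (0, 0, 0))
    (heq : x ^ 2 - a * y ^ 2 = b * z ^ 2) (hα : α ^ 2 = a) (hp : p.Prime) (hp2 : p ≠ 2)
    (hpa : ¬ (p : ℤ) ∣ a) (hpb : ¬ (p : ℤ) ∣ b) :
    ∃! t : ℚ, t ∈ ({1, (p : ℚ)} : Set ℚ) ∧ UnramifiedOver ℚ (twist a b α x y t) p := by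
  obtain ⟨r, X, Y, Z, β, γ, hr, h, hγ, -, hprim, htwist⟩ :=
    exists_primitive_isRedeiTriple ha ha1 hb hb1 hxyz heq hα hp
  have hr' : (r : ℚ) = 1 ∨ (r : ℚ) = p := by exact_mod_cast hr
  have hr0 : (r : ℚ) ≠ 0 := by
    have := hp.ne_zero
    rcases hr' with h | h <;> simp [h, this]
  have hunr := h.unramifiedOver_twist_one hγ hp hp2 hpa hpb hprim
  have hr1 : twist a b α x y r = twist a b α X Y (1 : ℤ) :=
    (htwist r).trans (twist_congr hr0 (by simp [sq]) (by simp [sq]))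
  refine ⟨r, ⟨hr', by rwa [hr1]⟩, fun t ⟨ht, htU⟩ ↦ ?_⟩
  by_contra htr
  have htp : twist a b α x y t = twist a b α X Y (p : ℤ) := by
    rw [htwist, show t * r = (p : ℤ) by
      rcases ht with rfl | rfl <;> rcases hr' with hr' | hr' <;> simp_all]
  exact h.mul_ne_mul_of_unramifiedOver hγ (by exact_mod_cast hp.ne_zero) one_ne_zero hp
    (htp ▸ htU) hunr (Nat.prime_iff_prime_int.mp hp).not_dvd_one rfl

theorem exists_mem_twistReps_mul_eq_sq_mul {r δ : ℤ} (hr : r = 1 ∨ r = 2) (hδ : δ ∈ twistReps) :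
    ∃ t ∈ twistReps, ∃ q : ℤ, q ≠ 0 ∧ t * r = q ^ 2 * δ := by
  rcases hr with rfl | rfl
  · exact ⟨δ, hδ, 1, one_ne_zero, by ring⟩
  · rcases hδ with rfl | rfl | rfl | rfl
    exacts [⟨2, by simp [twistReps], 2, by decide⟩, ⟨-2, by simp [twistReps], 2, by decide⟩,
      ⟨1, by simp [twistReps], 1, by decide⟩, ⟨-1, by simp [twistReps], 1, by decide⟩]

theorem existsUnique_unramifiedOver_twist_two (ha : Squarefree a) (ha1 : a ≠ 1)
    (hb : Squarefree b) (hb1 : b ≠ 1) (hxyz : (x, y, z) ≠ (0, 0, 0))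
    (heq : x ^ 2 - a * y ^ 2 = b * z ^ 2) (hα : α ^ 2 = a) (ha4 : a % 4 = 1) (hb4 : b % 4 = 1) :
    ∃! t : ℚ, t ∈ ({1, -1, 2, -2} : Set ℚ) ∧ UnramifiedOver ℚ (twist a b α x y t) 2 := by
  obtain ⟨r, X, Y, Z, β, γ, hr, h, hγ, -, hprim, htwist⟩ :=
    exists_primitive_isRedeiTriple ha ha1 hb hb1 hxyz heq hα Nat.prime_two
  have hr0 : r ≠ 0 := by rcases hr with rfl | rfl <;> decide
  have htwist' (t : ℤ) : twist a b α x y t = twist a b α X Y (t * r : ℤ) := by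
    rw [htwist, Int.cast_mul]
  obtain ⟨δ, hδ, hδU⟩ := h.exists_unramifiedOver_twist_two hγ ha4 hb4 hprim
  obtain ⟨t, ht, q, hq, htq⟩ := exists_mem_twistReps_mul_eq_sq_mul hr hδ
  have htU : UnramifiedOver ℚ (twist a b α x y t) 2 := by
    have htδ : twist a b α x y t = twist a b α X Y δ := by
      rw [htwist', htq]
      exact twist_congr (Int.cast_ne_zero.mpr hq) (by push_cast; ring) (by push_cast; ring)
    rwa [htδ]
  rw [← cast_image_twistReps]
  refine ⟨t, ⟨Set.mem_image_of_mem _ ht, htU⟩, ?_⟩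
  rintro - ⟨⟨s, hs, rfl⟩, hsU⟩
  rw [htwist'] at hsU htU
  have hs0 := ne_zero_of_mem_twistReps hs
  have ht0 := ne_zero_of_mem_twistReps ht
  have hst := h.isFourPowMulOneMod_mul hγ (mul_ne_zero hs0 hr0) (mul_ne_zero ht0 hr0) hsU htU
  rw [show s * r * (t * r) = r ^ 2 * (s * t) by ring,
    IsFourPowMulOneMod.sq_mul_iff hr0 (mul_ne_zero hs0 ht0)] at hst
  rw [hst.eq_of_mul hs ht]

theorem unramifiedOver_extFieldOverK_of_dvd (ha : Squarefree a) (ha1 : a ≠ 1)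
    (hb : Squarefree b) (hb1 : b ≠ 1) (hxyz : (x, y, z) ≠ (0, 0, 0))
    (heq : x ^ 2 - a * y ^ 2 = b * z ^ 2) (hα : α ^ 2 = a) (hp : p.Prime) (hp2 : p ≠ 2)
    (hpa : (p : ℤ) ∣ a) (hpb : ¬ (p : ℤ) ∣ b) :
    UnramifiedOver (sqrtField (a * b)) (extFieldOverK a b α x y) p := by
  obtain ⟨r, X, Y, Z, β, γ, hr, h, hγ, -, hprim, htwist⟩ :=
    exists_primitive_isRedeiTriple ha ha1 hb hb1 hxyz heq hα hp
  have hpa2 : ¬ (p : ℤ) * p ∣ a := fun h ↦ (Nat.prime_iff_prime_int.mp hp).not_isUnit (ha p h)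
  have hext : extFieldOverK a b α x y = twistOverK a b α X Y r := by
    rw [← twistOverK_congr ((htwist 1).trans (by rw [one_mul])), twistOverK, one_mul, one_mul]
  rw [hext]
  exact h.unramifiedOver_twistOverK_of_dvd_left hγ hr hp hp2 hpa hpa2 hpb hprim

theorem ncard_unramifiedOver_twistOverK_eq_two (ha : Squarefree a) (hb : Squarefree b)
    (hb1 : b ≠ 1) (hxyz : (x, y, z) ≠ (0, 0, 0)) (heq : x ^ 2 - a * y ^ 2 = b * z ^ 2)
    (hα : α ^ 2 = a) (ha4 : a % 4 ≠ 1) (hb8 : b % 8 = 1) :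
    {t : ℚ | t ∈ ({1, -1, 2, -2} : Set ℚ) ∧
      UnramifiedOver (sqrtField (a * b)) (twistOverK a b α x y t) 2}.ncard = 2 := by
  obtain ⟨r, X, Y, Z, β, γ, hr, h, hγ, hY, -, htwist⟩ :=
    exists_primitive_isRedeiTriple ha (by omega) hb hb1 hxyz heq hα Nat.prime_two
  have hr0 : r ≠ 0 := by rcases hr with rfl | rfl <;> decide
  obtain ⟨n, hn, hU⟩ := h.exists_unramifiedOver_iff_isFourPowMulOneMod hγ ha.ne_zero hb8 hY
  have hUtwist {t : ℤ} (ht : t ∈ twistReps) :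
      UnramifiedOver (sqrtField (a * b)) (twistOverK a b α x y t) 2 ↔
        IsFourPowMulOneMod (t * (r * n)) ∨ IsFourPowMulOneMod (t * (r * n * a)) := by
    have htr : t * r ∣ 4 := by
      rcases hr with rfl | rfl <;> rcases ht with rfl | rfl | rfl | rfl <;> decide
    have htr' : twist a b α x y t = twist a b α X Y (t * r : ℤ) := by rw [htwist, Int.cast_mul]
    rw [twistOverK_congr htr', hU _ htr]
    simp only [mul_assoc]
  refine Eq.trans ?_ (IsFourPowMulOneMod.ncard_twistReps_eq_two (mul_ne_zero hr0 hn) ha.ne_zero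
    (not_isFourPowMulOneMod_of_squarefree ha ha4))
  rw [← cast_image_twistReps,
    ← Set.ncard_image_of_injective _ (Int.cast_injective (α := ℚ))]
  congr 1
  ext t
  constructor
  · rintro ⟨⟨t, ht, rfl⟩, htU⟩
    exact ⟨t, ⟨ht, (hUtwist ht).mp htU⟩, rfl⟩
  · rintro ⟨t, ⟨ht, htU⟩, rfl⟩
    exact ⟨⟨t, ht, rfl⟩, (hUtwist ht).mpr htU⟩

theorem exists_intCast_twist_eq {t : ℚ} (ht : t ≠ 0) :
    ∃ m : ℤ, m ≠ 0 ∧ twist a b α x y t = twist a b α x y m := by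
  have hden : (t.den : ℚ) ≠ 0 := Nat.cast_ne_zero.mpr t.den_ne_zero
  refine ⟨t.num * t.den, mul_ne_zero (Rat.num_ne_zero.mpr ht) (by exact_mod_cast hden), ?_⟩
  have h : t = (t.den : ℚ)⁻¹ ^ 2 * (t.num * t.den : ℤ) := by
    nth_rw 1 [← Rat.num_div_den t]
    push_cast
    field_simp
  refine twist_congr (inv_ne_zero hden) ?_ ?_ <;> rw [← mul_assoc, ← h]

theorem not_unramifiedOver_twistOverK_and_mod_four_eq_three (ha : Squarefree a)
    (hb : Squarefree b) (hxyz : (x, y, z) ≠ (0, 0, 0))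
    (heq : x ^ 2 - a * y ^ 2 = b * z ^ 2) (hα : α ^ 2 = a) (ha4 : a % 4 ≠ 1) (hb8 : b % 8 = 5) :
    (∀ t : ℚ, t ≠ 0 → ¬ UnramifiedOver (sqrtField (a * b)) (twistOverK a b α x y t) 2) ∧
      a % 4 = 3 := by
  obtain ⟨r, X, Y, Z, β, γ, hr, h, hγ, hY, hprim, htwist⟩ :=
    exists_primitive_isRedeiTriple ha (by omega) hb (by omega) hxyz heq hα Nat.prime_two
  have hr0 : (r : ℚ) ≠ 0 := by rcases hr with rfl | rfl <;> simp
  have ha3 := mod_four_eq_three_of_norm_eq ha ha4 hb8 h.norm_eq hprim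
  refine ⟨fun t ht ↦ ?_, ha3⟩
  obtain ⟨m, hm, htm⟩ := exists_intCast_twist_eq (a := a) (b := b) (α := α) (x := X) (y := Y)
    (mul_ne_zero ht hr0)
  rw [twistOverK_congr ((htwist t).trans htm)]
  exact h.not_unramifiedOver_twistOverK hγ hY hm ha3 hb8

end RationalTwists

section Discriminants

theorem discr_pair_eq_trace {R S : Type*} [CommRing R] [CommRing S] [Algebra R S] (x y : S) :
    Algebra.discr R ![x, y] = Algebra.trace R S (x * x) * Algebra.trace R S (y * y) -
      Algebra.trace R S (x * y) ^ 2 := by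
  rw [Algebra.discr_def, Matrix.det_fin_two]
  simp only [Algebra.traceMatrix_apply, Algebra.traceForm_apply, Matrix.cons_val_zero,
    Matrix.cons_val_one, mul_comm y x, pow_two]

variable {K : Type*} [Field K] [NumberField K] [Algebra.IsQuadraticExtension ℚ K]
  {σ : Gal(K/ℚ)} {s : K} {c : ℤ}

variable (K) in
theorem card_algEquiv_eq_two : Nat.card Gal(K/ℚ) = 2 := by
  rw [IsGalois.card_aut_eq_finrank, Algebra.IsQuadraticExtension.finrank_eq_two]

theorem univ_algEquiv_eq_pair [DecidableEq Gal(K/ℚ)] (hσ : σ ≠ 1) :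
    (Finset.univ : Finset Gal(K/ℚ)) = {1, σ} :=
  ((Finset.card_eq_iff_eq_univ _).mp <| by
    rw [Finset.card_pair hσ.symm, ← Nat.card_eq_fintype_card, card_algEquiv_eq_two]).symm

theorem intCast_trace_eq_add (hσ : σ ≠ 1) (x : 𝓞 K) :
    (Algebra.trace ℤ (𝓞 K) x : K) = x + σ x := by
  classical
  rw [← Rat.cast_intCast, Algebra.coe_trace_int, ← eq_ratCast (algebraMap ℚ K),
    trace_eq_sum_automorphisms, univ_algEquiv_eq_pair hσ, Finset.sum_pair hσ.symm,
    AlgEquiv.one_apply]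

theorem intCast_norm_eq_mul (hσ : σ ≠ 1) (x : 𝓞 K) : (Algebra.norm ℤ x : K) = x * σ x := by
  classical
  rw [← Rat.cast_intCast, Algebra.coe_norm_int, ← eq_ratCast (algebraMap ℚ K),
    Algebra.norm_eq_prod_automorphisms, univ_algEquiv_eq_pair hσ, Finset.prod_pair hσ.symm,
    AlgEquiv.one_apply]

theorem intCast_discr_pair (hσ : σ ≠ 1) (x y : 𝓞 K) :
    (Algebra.discr ℤ ![x, y] : K) = (x * σ y - y * σ x) ^ 2 := by
  rw [discr_pair_eq_trace]
  push_cast [intCast_trace_eq_add hσ, map_mul]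
  ring

theorem discr_pair_emod_four (x y : 𝓞 K) :
    Algebra.discr ℤ ![x, y] % 4 = 0 ∨ Algebra.discr ℤ ![x, y] % 4 = 1 := by
  obtain ⟨σ, hσ, -⟩ := (Nat.card_eq_two_iff' 1).mp (card_algEquiv_eq_two K)
  -- `(x σ(y) - y σ(x)) ^ 2 = (x σ(y) + y σ(x)) ^ 2 - 4 x σ(x) y σ(y)`
  obtain ⟨t, ht⟩ : ∃ t : ℤ, t = (x : K) * σ y + y * σ x :=
    ⟨Algebra.trace ℤ (𝓞 K) x * Algebra.trace ℤ (𝓞 K) y - Algebra.trace ℤ (𝓞 K) (x * y), by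
      push_cast [intCast_trace_eq_add hσ, map_mul]
      ring⟩
  have hdiscr : Algebra.discr ℤ ![x, y] =
      t ^ 2 - 4 * (Algebra.norm ℤ x * Algebra.norm ℤ y) := by
    refine Int.cast_injective (α := K) ?_
    rw [intCast_discr_pair hσ]
    push_cast [ht, intCast_norm_eq_mul hσ]
    ring
  rw [hdiscr, Int.sub_mul_emod_self_left]
  rcases Int.even_or_odd t with h | h
  · exact .inl (Int.emod_eq_zero_of_dvd (pow_dvd_pow_of_dvd h.two_dvd 2))
  · exact .inr (Int.sq_mod_four_eq_one_of_odd h)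

variable (K) in
theorem finrank_ringOfIntegers_eq_two : Module.finrank ℤ (𝓞 K) = 2 := by
  rw [RingOfIntegers.rank, Algebra.IsQuadraticExtension.finrank_eq_two]

variable (K) in
theorem discr_emod_four : discr K % 4 = 0 ∨ discr K % 4 = 1 := by
  let e := Module.finBasisOfFinrankEq ℤ (𝓞 K) (finrank_ringOfIntegers_eq_two K)
  have he : ⇑e = ![e 0, e 1] := List.ofFn_injective rfl
  rw [← discr_eq_discr K e, he]
  exact discr_pair_emod_four _ _

theorem exists_discr_pair_eq_sq_mul_discr (x y : 𝓞 K) :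
    ∃ n : ℤ, Algebra.discr ℤ ![x, y] = n ^ 2 * discr K := by
  let e := Module.finBasisOfFinrankEq ℤ (𝓞 K) (finrank_ringOfIntegers_eq_two K)
  refine ⟨(e.toMatrix ![x, y]).det, ?_⟩
  rw [← discr_eq_discr K e, ← Algebra.discr_of_matrix_vecMul, e.toMatrix_map_vecMul]

theorem exists_map_eq_neg (hc : ¬ IsSquare c) (hs : s ^ 2 = c) :
    ∃ σ : Gal(K/ℚ), σ ≠ 1 ∧ σ s = -s := by
  have hbot : s ∉ (⊥ : IntermediateField ℚ K) := by
    rintro ⟨q, rfl⟩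
    refine hc (Rat.isSquare_intCast_iff.mp ⟨q, ?_⟩)
    rw [← pow_two]
    exact (algebraMap ℚ K).injective (by simpa using hs.symm)
  simp only [IsGalois.mem_bot_iff_fixed, not_forall] at hbot
  obtain ⟨σ, hσ⟩ := hbot
  exact ⟨σ, fun h ↦ hσ (by rw [h, AlgEquiv.one_apply]),
    (map_eq_or_eq_neg_of_sq (by rw [hs, map_intCast])).resolve_left hσ⟩

theorem not_isSquare_of_squarefree (hc : Squarefree c) (hc1 : c ≠ 1) : ¬ IsSquare c := by
  rintro ⟨d, rfl⟩
  exact hc1 (Int.isUnit_mul_self (hc d dvd_rfl))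

theorem discr_eq_of_mod_four_eq_one (hc : Squarefree c) (hc1 : c ≠ 1) (hs : s ^ 2 = c)
    (h : c % 4 = 1) : discr K = c := by
  obtain ⟨σ, hσ, hσs⟩ := exists_map_eq_neg (not_isSquare_of_squarefree hc hc1) hs
  obtain ⟨ω, rfl⟩ := exists_eq_two_mul_sub_one hs h
  obtain ⟨n, hn⟩ := exists_discr_pair_eq_sq_mul_discr (1 : 𝓞 K) ω
  have hdiscr : Algebra.discr ℤ ![(1 : 𝓞 K), ω] = c := by
    have hσω : σ ω = 1 - ω := by
      simp only [map_sub, map_mul, map_ofNat, map_one] at hσs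
      linear_combination hσs / 2
    refine Int.cast_injective (α := K) ?_
    rw [intCast_discr_pair hσ, hσω, ← hs]
    simp only [map_one, one_mul, mul_one]
    ring
  rw [hdiscr] at hn
  have hn1 : n ^ 2 = 1 := by
    rw [pow_two, Int.isUnit_mul_self (hc n ⟨discr K, by rw [hn, pow_two]⟩)]
  rw [hn, hn1, one_mul]

theorem discr_eq_four_mul_of_mod_four_ne_one (hc : Squarefree c) (hs : s ^ 2 = c)
    (h : c % 4 ≠ 1) : discr K = 4 * c := by
  obtain ⟨σ, hσ, hσs⟩ := exists_map_eq_neg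
    (not_isSquare_of_squarefree hc fun h1 ↦ h (by rw [h1]; rfl)) hs
  obtain ⟨s, rfl, -⟩ := exists_ringOfIntegers_of_sq_eq_intCast hs
  obtain ⟨n, hn⟩ := exists_discr_pair_eq_sq_mul_discr (1 : 𝓞 K) s
  have hdiscr : Algebra.discr ℤ ![(1 : 𝓞 K), s] = 4 * c := by
    refine Int.cast_injective (α := K) ?_
    rw [intCast_discr_pair hσ, hσs]
    push_cast [← hs, map_one]
    ring
  rw [hdiscr] at hn
  have hc4 := not_four_dvd_of_squarefree hc
  have hmod := discr_emod_four K
  have hodd : Odd n := by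
    rw [← Int.not_even_iff_odd]
    rintro ⟨m, rfl⟩
    have hm : c = m * m * discr K := by linarith
    rw [Int.isUnit_mul_self (hc m ⟨_, hm⟩), one_mul] at hm
    omega
  have hcop : IsCoprime (n * n) (4 : ℤ) := by
    have : IsCoprime n (2 ^ 2) := (Int.isCoprime_two_right.mpr hodd).pow_right
    exact this.mul_left this
  have hdvd : n * n ∣ c := hcop.dvd_of_dvd_mul_left ⟨discr K, by rw [hn, pow_two]⟩
  rw [hn, pow_two, Int.isUnit_mul_self (hc n hdvd), one_mul]

theorem isQuadraticExtension_sqrtField (hc : ¬ IsSquare c) :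
    Algebra.IsQuadraticExtension ℚ (sqrtField c) := by
  obtain ⟨s, hs⟩ := IsAlgClosed.exists_pow_nat_eq (c : ℂ) two_pos
  have hirr : Irreducible (Polynomial.X ^ 2 - Polynomial.C (c : ℚ)) :=
    X_pow_sub_C_irreducible_of_prime Nat.prime_two fun q hq ↦
      hc (Rat.isSquare_intCast_iff.mp ⟨q, by rw [← hq, pow_two]⟩)
  have hmin : Polynomial.X ^ 2 - Polynomial.C (c : ℚ) = minpoly ℚ s :=
    minpoly.eq_of_irreducible_of_monic hirr (by simp [hs]) (by monicity!)
  have hadjoin : sqrtField c = IntermediateField.adjoin ℚ {s} :=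
    (sqrtField_le hs (IntermediateField.mem_adjoin_simple_self ℚ s)).antisymm
      (IntermediateField.adjoin_simple_le_iff.mpr (mem_sqrtField hs))
  have hint : IsIntegral ℚ s := minpoly.ne_zero_iff.mp (hmin ▸ hirr.ne_zero)
  refine ⟨?_⟩
  rw [hadjoin, IntermediateField.adjoin.finrank hint, ← hmin, Polynomial.natDegree_X_pow_sub_C]

theorem exists_sqrtField_sq_eq (c : ℤ) : ∃ s : sqrtField c, s ^ 2 = c := by
  obtain ⟨s, hs⟩ := IsAlgClosed.exists_pow_nat_eq (c : ℂ) two_pos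
  exact ⟨⟨s, mem_sqrtField hs⟩, Subtype.ext (by simpa using hs)⟩

theorem Δ_of_mod_four_eq_one (hc : Squarefree c) (hc1 : c ≠ 1) (h : c % 4 = 1) : Δ c = c := by
  have := isQuadraticExtension_sqrtField (not_isSquare_of_squarefree hc hc1)
  obtain ⟨s, hs⟩ := exists_sqrtField_sq_eq c
  exact discr_eq_of_mod_four_eq_one hc hc1 hs h

theorem Δ_of_mod_four_ne_one (hc : Squarefree c) (h : c % 4 ≠ 1) : Δ c = 4 * c := by
  have := isQuadraticExtension_sqrtField (not_isSquare_of_squarefree hc (by omega))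
  obtain ⟨s, hs⟩ := exists_sqrtField_sq_eq c
  exact discr_eq_four_mul_of_mod_four_ne_one hc hs h

theorem mod_four_eq_one_of_not_two_dvd_Δ (hc : Squarefree c) (h : ¬ 2 ∣ Δ c) : c % 4 = 1 := by
  by_contra h4
  rw [Δ_of_mod_four_ne_one hc h4] at h
  omega

theorem mod_four_ne_one_of_even_Δ (hc : Squarefree c) (hc1 : c ≠ 1) (h : Even (Δ c)) :
    c % 4 ≠ 1 := by
  intro h4
  rw [Δ_of_mod_four_eq_one hc hc1 h4, Int.even_iff] at h
  omega

theorem dvd_Δ_iff (hc : Squarefree c) (hc1 : c ≠ 1) {p : ℕ} (hp : p.Prime) (hp2 : p ≠ 2) :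
    (p : ℤ) ∣ Δ c ↔ (p : ℤ) ∣ c := by
  by_cases h : c % 4 = 1
  · rw [Δ_of_mod_four_eq_one hc hc1 h]
  · have hcop : IsCoprime (p : ℤ) 4 := by
      exact_mod_cast ((Nat.coprime_primes hp Nat.prime_two).mpr hp2).pow_right 2
    rw [Δ_of_mod_four_ne_one hc h]
    exact ⟨hcop.dvd_of_dvd_mul_left, fun h ↦ h.mul_left 4⟩

theorem mod_eight_of_Δ (hc : Squarefree c) (hc1 : c ≠ 1) {r : ℤ} (hr : r % 2 = 1)
    (h : Δ c ≡ r [ZMOD 8]) : c % 8 = r % 8 := by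
  by_cases h4 : c % 4 = 1
  · rwa [Δ_of_mod_four_eq_one hc hc1 h4] at h
  · rw [Δ_of_mod_four_ne_one hc h4, Int.ModEq] at h
    omega

end Discriminants

end RedeiField

open RedeiField in
theorem mainTheorem6 (a b : ℤ) (ha : Squarefree a) (hb : Squarefree b) (ha1 : a ≠ 1) (hb1 : b ≠ 1)
    (p : ℕ) (hp : p.Prime) (hpb : ¬ (p : ℤ) ∣ Δ b)
    (x y z : ℚ) (hxyz : (x, y, z) ≠ (0, 0, 0)) (hsol : x ^ 2 - a * y ^ 2 - b * z ^ 2 = 0)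
    (α : ℂ) (hα : α ^ 2 = (a : ℂ)) :
    (¬ (p : ℤ) ∣ Δ a →
      (p ≠ 2 → ∃! t : ℚ, t ∈ ({1, (p : ℚ)} : Set ℚ) ∧ UnramifiedOver ℚ (twist a b α x y t) p) ∧
      (p = 2 → ∃! t : ℚ, t ∈ ({1, -1, 2, -2} : Set ℚ) ∧
        UnramifiedOver ℚ (twist a b α x y t) p)) ∧
    (p ≠ 2 → (p : ℤ) ∣ Δ a →
      UnramifiedOver (sqrtField (a * b)) (extFieldOverK a b α x y) p) ∧
    (Even (Δ a) → Δ b ≡ 1 [ZMOD 8] →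
      {t : ℚ | t ∈ ({1, -1, 2, -2} : Set ℚ) ∧
        UnramifiedOver (sqrtField (a * b)) (twistOverK a b α x y t) 2}.ncard = 2) ∧
    (Even (Δ a) → Δ b ≡ 5 [ZMOD 8] →
      (∀ t : ℚ, t ≠ 0 →
        ¬ UnramifiedOver (sqrtField (a * b)) (twistOverK a b α x y t) 2) ∧
      Δ a ≡ 4 [ZMOD 8]) := by
  have heq : x ^ 2 - a * y ^ 2 = b * z ^ 2 := by linear_combination hsol
  refine ⟨fun hpa ↦ ⟨fun hp2 ↦ ?_, ?_⟩, fun hp2 hpa ↦ ?_, fun hΔa hΔb ↦ ?_, fun hΔa hΔb ↦ ?_⟩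
  · rw [dvd_Δ_iff ha ha1 hp hp2] at hpa
    rw [dvd_Δ_iff hb hb1 hp hp2] at hpb
    exact existsUnique_unramifiedOver_twist_of_odd ha ha1 hb hb1 hxyz heq hα hp hp2 hpa hpb
  · rintro rfl
    exact existsUnique_unramifiedOver_twist_two ha ha1 hb hb1 hxyz heq hα
      (mod_four_eq_one_of_not_two_dvd_Δ ha hpa) (mod_four_eq_one_of_not_two_dvd_Δ hb hpb)
  · rw [dvd_Δ_iff ha ha1 hp hp2] at hpa
    rw [dvd_Δ_iff hb hb1 hp hp2] at hpb
    exact unramifiedOver_extFieldOverK_of_dvd ha ha1 hb hb1 hxyz heq hα hp hp2 hpa hpb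
  · exact ncard_unramifiedOver_twistOverK_eq_two ha hb hb1 hxyz heq hα
      (mod_four_ne_one_of_even_Δ ha ha1 hΔa) (mod_eight_of_Δ hb hb1 rfl hΔb)
  · have ha4 := mod_four_ne_one_of_even_Δ ha ha1 hΔa
    obtain ⟨hramified, ha3⟩ := not_unramifiedOver_twistOverK_and_mod_four_eq_three ha hb hxyz heq
      hα ha4 (mod_eight_of_Δ hb hb1 rfl hΔb)
    refine ⟨hramified, ?_⟩
    rw [Δ_of_mod_four_ne_one ha ha4, Int.ModEq]
    omega
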